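/- **Representation of the Gaussian Heegard–Berger rate–distortion function.** Let $M\ge 1$, $\sigma_X^2>0$, $0\le s_1<\dots<s_M$ and $D_1,\dots,D_M>0$; all logarithms and information quantities are in nats. Let $X\sim\mathcal N(0,\sigma_X^2)$, and let $Y_1,\dots,Y_M$ be real random variables such that for each $i$ the pair $(X,Y_i)$ has the law of $(X,\sqrt{s_i}X+Z)$ with $Z\sim\mathcal N(0,1)$ independent of $X$, and such that $X\leftrightarrow Y_M\leftrightarrow Y_{M-1}\leftrightarrow\dots\leftrightarrow Y_1$ is a Markov chain (such $Y_1,\dots,Y_M$ exist). Let $P(\mathbf D)$ be the set of all $W_1^M=(W_1,\dots,W_M)$ (with values in arbitrary standard Borel spaces) jointly distributed with $X,Y_1^M$ such that $W_1^M\leftrightarrow X\leftrightarrow Y_M\leftrightarrow\dots\leftrightarrow Y_1$ is a Markov chain and there are measurable decoding functions $\hat X_i(Y_i,W_1^i)$ with $\mathrm E[(X-\hat X_i)^2]\le D_i$ for $i=1,\dots,M$, and let $$R_{HB}(\mathbf D)=\inf_{W_1^M\in P(\mathbf D)}\ \sum_{i=1}^M I(X;W_i\mid Y_i,W_1^{i-1}).$$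 Put $s_0=0$, $V_0=\sigma_X^2$ and, for $i=1,\dots,M$, $$V_i=\min\bigl((V_{i-1}^{-1}+s_i-s_{i-1})^{-1},\,D_i\bigr).$$ Then the infimum is attained and $$R_{HB}(\mathbf D)=-\tfrac12\log(\sigma_X^{-2}+s_1)-\tfrac12\log V_M-\tfrac12\sum_{i=1}^{M-1}\log\bigl(1+(s_{i+1}-s_i)V_i\bigr).$$ It is achieved by $W_i^*=a_iX+N_i$, where $N_1,\dots,N_M$ are i.i.d. $\mathcal N(0,1)$, jointly independent of $(X,Y_1^M)$, and $a_i=\bigl(V_i^{-1}-V_{i-1}^{-1}-(s_i-s_{i-1})\bigr)^{1/2}$: one has $W^*\in P(\mathbf D)$, $\mathrm{VAR}[X\mid Y_i,W_1^*,\dots,W_i^*]=V_i$ almost surely, and $I(X;W_i^*\mid Y_i,W_1^*,\dots,W_{i-1}^*)=\frac12\log\frac{(V_{i-1}^{-1}+s_i-s_{i-1})^{-1}}{V_i}$ for every $i$, and these rates add up to $R_{HB}(\mathbf D)$. In particular, for $M=2$, $$R_{HB}(D_1,D_2)=-\tfrac12\log(\sigma_X^{-2}+s_1)-\tfrac12\log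 V_2-\tfrac12\log\bigl(1+(s_2-s_1)V_1\bigr),$$ with $V_1=\min\bigl((\sigma_X^{-2}+s_1)^{-1},D_1\bigr)$ and $V_2=\min\bigl((V_1^{-1}+s_2-s_1)^{-1},D_2\bigr)$. -/

import Mathlib

open MeasureTheory ProbabilityTheory InformationTheory
open scoped ENNReal NNReal

noncomputable section

namespace HeegardBerger

/-- Conditional mutual information `I(X; W | Z)` in nats: the Kullback–Leibler divergence between
the joint law of `(Z, X, W)` and the law under which `X` and `W` are conditionally independent
given `Z`, with the same laws of `(Z, X)` and `(Z, W)`. -/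
def condMutualInfo {Ω 𝒳 𝒲 𝒵 : Type} [MeasurableSpace Ω] [MeasurableSpace 𝒳]
    [StandardBorelSpace 𝒳] [Nonempty 𝒳] [MeasurableSpace 𝒲] [StandardBorelSpace 𝒲] [Nonempty 𝒲]
    [MeasurableSpace 𝒵] (X : Ω → 𝒳) (W : Ω → 𝒲) (Z : Ω → 𝒵)
    (μ : Measure Ω) [IsFiniteMeasure μ] : ℝ≥0∞ :=
  klDiv (μ.map (fun ω => (Z ω, X ω, W ω)))
    (μ.map Z ⊗ₘ (condDistrib X Z μ ×ₖ condDistrib W Z μ))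

/-- What the decoder knows before using layer `i`: `(Y_i, W_1, …, W_{i-1})`. -/
def obsLT {Ω 𝒴 : Type} {M : ℕ} {𝒲 : Fin M → Type} (Y : Fin M → Ω → 𝒴)
    (W : ∀ i, Ω → 𝒲 i) (i : Fin M) (ω : Ω) : 𝒴 × (∀ j : {j : Fin M // j < i}, 𝒲 j) :=
  (Y i ω, fun j => W j ω)

/-- What the decoder knows after using layer `i`: `(Y_i, W_1, …, W_i)`. -/
def obsLE {Ω 𝒴 : Type} {M : ℕ} {𝒲 : Fin M → Type} (Y : Fin M → Ω → 𝒴)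
    (W : ∀ i, Ω → 𝒲 i) (i : Fin M) (ω : Ω) : 𝒴 × (∀ j : {j : Fin M // j ≤ i}, 𝒲 j) :=
  (Y i ω, fun j => W j ω)

/-- The random variables form a Markov chain `U ↔ Y_M ↔ Y_{M-1} ↔ ⋯ ↔ Y_1`: for every `i`,
`(U, Y_M, …, Y_{i+1})` and `(Y_{i-1}, …, Y_1)` are conditionally independent given `Y_i`. -/
def IsDegraded {Ω 𝒰 𝒴 : Type} [MeasurableSpace Ω] [StandardBorelSpace Ω] [MeasurableSpace 𝒰]
    [MeasurableSpace 𝒴] {M : ℕ} (U : Ω → 𝒰) (Y : Fin M → Ω → 𝒴) (hY : ∀ i, Measurable (Y i))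
    (μ : Measure Ω) [IsFiniteMeasure μ] : Prop :=
  ∀ i : Fin M, CondIndepFun (MeasurableSpace.comap (Y i) inferInstance) (hY i).comap_le
    (fun ω => (U ω, fun j : {j : Fin M // i < j} => Y j ω))
    (fun ω => fun j : {j : Fin M // j < i} => Y j ω) μ

/-- The auxiliary variables `W = (W_1, …, W_M)` on `(Ω, μ)` belong to `P(D)` for the source and
side information `(X, Y_1, …, Y_M)` of joint law `Q` and the distortion measures `d i`. -/
structure IsAdmissible {Ω 𝒳 𝒴 𝒳' : Type} [MeasurableSpace Ω] [StandardBorelSpace Ω]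
    [MeasurableSpace 𝒳] [MeasurableSpace 𝒴] [MeasurableSpace 𝒳'] {M : ℕ} {𝒲 : Fin M → Type}
    [∀ i, MeasurableSpace (𝒲 i)] (Q : Measure (𝒳 × (Fin M → 𝒴)))
    (d : Fin M → 𝒳 → 𝒳' → ℝ≥0∞) (D : Fin M → ℝ)
    (μ : Measure Ω) [IsFiniteMeasure μ] (X : Ω → 𝒳) (Y : Fin M → Ω → 𝒴)
    (W : ∀ i, Ω → 𝒲 i) : Prop where
  measurable_X : Measurable X
  measurable_Y : ∀ i, Measurable (Y i)
  measurable_W : ∀ i, Measurable (W i)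
  /-- `(X, Y_1, …, Y_M)` has law `Q`. -/
  law : μ.map (fun ω => (X ω, fun i => Y i ω)) = Q
  /-- The Markov chain `W_1^M ↔ X ↔ Y_M ↔ ⋯ ↔ Y_1` at `X`. -/
  markov_X : CondIndepFun (MeasurableSpace.comap X inferInstance) measurable_X.comap_le
    (fun ω i => W i ω) (fun ω i => Y i ω) μ
  /-- The Markov chain `W_1^M ↔ X ↔ Y_M ↔ ⋯ ↔ Y_1` at each `Y_i`. -/
  markov_Y : IsDegraded (fun ω => ((fun i => W i ω : ∀ i, 𝒲 i), X ω)) Y measurable_Y μ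
  /-- Decoding functions of `(Y_i, W_1, …, W_i)` meet the distortion constraints. -/
  distortion : ∀ i, ∃ φ : 𝒴 × (∀ j : {j : Fin M // j ≤ i}, 𝒲 j) → 𝒳', Measurable φ ∧
    ∫⁻ ω, d i (X ω) (φ (obsLE Y W i ω)) ∂μ ≤ ENNReal.ofReal (D i)

/-- The objective `∑ i, I(X; W_i | Y_i, W_1, …, W_{i-1})`. -/
def layeredRate {Ω 𝒳 𝒴 : Type} [MeasurableSpace Ω] [MeasurableSpace 𝒳] [StandardBorelSpace 𝒳]
    [Nonempty 𝒳] [MeasurableSpace 𝒴] {M : ℕ} {𝒲 : Fin M → Type} [∀ i, MeasurableSpace (𝒲 i)]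
    [∀ i, StandardBorelSpace (𝒲 i)] [∀ i, Nonempty (𝒲 i)]
    (μ : Measure Ω) [IsFiniteMeasure μ] (X : Ω → 𝒳) (Y : Fin M → Ω → 𝒴)
    (W : ∀ i, Ω → 𝒲 i) : ℝ≥0∞ :=
  ∑ i, condMutualInfo X (W i) (obsLT Y W i) μ

/-- The values of the objective over `P(D)`. The auxiliary variables take values in arbitrary
standard Borel spaces. -/
def achievableRates {𝒳 𝒴 𝒳' : Type} [MeasurableSpace 𝒳] [StandardBorelSpace 𝒳] [Nonempty 𝒳]
    [MeasurableSpace 𝒴] [MeasurableSpace 𝒳'] {M : ℕ} (Q : Measure (𝒳 × (Fin M → 𝒴)))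
    (d : Fin M → 𝒳 → 𝒳' → ℝ≥0∞) (D : Fin M → ℝ) : Set ℝ≥0∞ :=
  {R | ∃ (Ω : Type) (_ : MeasurableSpace Ω) (_ : StandardBorelSpace Ω)
      (μ : Measure Ω) (_ : IsProbabilityMeasure μ)
      (𝒲 : Fin M → Type) (_ : ∀ i, MeasurableSpace (𝒲 i)) (_ : ∀ i, StandardBorelSpace (𝒲 i))
      (_ : ∀ i, Nonempty (𝒲 i))
      (X : Ω → 𝒳) (Y : Fin M → Ω → 𝒴) (W : ∀ i, Ω → 𝒲 i),
      IsAdmissible Q d D μ X Y W ∧ R = layeredRate μ X Y W}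

/-- The Heegard–Berger rate–distortion function `R_HB(D)`, in nats. -/
def rateDistortion {𝒳 𝒴 𝒳' : Type} [MeasurableSpace 𝒳] [StandardBorelSpace 𝒳] [Nonempty 𝒳]
    [MeasurableSpace 𝒴] [MeasurableSpace 𝒳'] {M : ℕ} (Q : Measure (𝒳 × (Fin M → 𝒴)))
    (d : Fin M → 𝒳 → 𝒳' → ℝ≥0∞) (D : Fin M → ℝ) : ℝ≥0∞ :=
  sInf (achievableRates Q d D)

/-- Squared error distortion in every state. -/
def sqDist {M : ℕ} (_ : Fin M) (x x' : ℝ) : ℝ≥0∞ := ENNReal.ofReal ((x - x') ^ 2)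

/-- The law of `(X, √s X + Z)` for independent `X ∼ N(0, σ²)` and `Z ∼ N(0, 1)`. -/
def gaussianPair (σ : ℝ≥0) (s : ℝ) : Measure (ℝ × ℝ) :=
  ((gaussianReal 0 (σ ^ 2)).prod (gaussianReal 0 1)).map (fun p => (p.1, √s * p.1 + p.2))

/-- `Q` is a joint law of `(X, Y_1, …, Y_M)` with the same marginals `p(x, y_i)` as
`Y'_i = √(s_i) X + Z`, `X ∼ N(0, σ²)`, and which is physically degraded:
`X ↔ Y_M ↔ ⋯ ↔ Y_1`. -/
structure IsGaussianDegradedLaw {M : ℕ} (σ : ℝ≥0) (s : Fin M → ℝ)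
    (Q : Measure (ℝ × (Fin M → ℝ))) [IsProbabilityMeasure Q] : Prop where
  marginal : ∀ i, Q.map (fun q => (q.1, q.2 i)) = gaussianPair σ (s i)
  degraded : IsDegraded (fun q : ℝ × (Fin M → ℝ) => q.1) (fun i q => q.2 i)
    (fun i => (measurable_pi_apply i).comp measurable_snd) Q

/-- `V_1 = min((σ^{-2} + s_1)^{-1}, D_1)` and
`V_{i+1} = min((V_i^{-1} + s_{i+1} - s_i)^{-1}, D_{i+1})`; the number of states is `m + 1` and the
indices start at `0`. -/
def V {m : ℕ} (σ : ℝ≥0) (s D : Fin (m + 1) → ℝ) (i : Fin (m + 1)) : ℝ :=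
  Fin.induction (motive := fun _ => ℝ)
    (min ((((σ : ℝ) ^ 2)⁻¹ + s 0)⁻¹) (D 0))
    (fun j v => min ((v⁻¹ + s j.succ - s j.castSucc)⁻¹) (D j.succ)) i

/-- `(V_{i-1}^{-1} + s_i - s_{i-1})^{-1}`, with `V_0 = σ²` and `s_0 = 0`. -/
def priorV {m : ℕ} (σ : ℝ≥0) (s D : Fin (m + 1) → ℝ) (i : Fin (m + 1)) : ℝ :=
  Fin.cases (motive := fun _ => ℝ) ((((σ : ℝ) ^ 2)⁻¹ + s 0)⁻¹)
    (fun j => ((V σ s D j.castSucc)⁻¹ + s j.succ - s j.castSucc)⁻¹) i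

/-- The coefficient `a_i = (V_i^{-1} - V_{i-1}^{-1} - (s_i - s_{i-1}))^{1/2}`. -/
def coeff {m : ℕ} (σ : ℝ≥0) (s D : Fin (m + 1) → ℝ) (i : Fin (m + 1)) : ℝ :=
  √((V σ s D i)⁻¹ - (priorV σ s D i)⁻¹)

/-- `W_i = a_i X + N_i`. -/
def gaussianAux {Ω : Type} {m : ℕ} (σ : ℝ≥0) (s D : Fin (m + 1) → ℝ) (X : Ω → ℝ)
    (N : Fin (m + 1) → Ω → ℝ) (i : Fin (m + 1)) (ω : Ω) : ℝ :=
  coeff σ s D i * X ω + N i ω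

/-- `-½ log(σ^{-2} + s_1) - ½ log V_M - ½ ∑_{i<M} log(1 + (s_{i+1} - s_i) V_i)`. -/
def gaussianRate {m : ℕ} (σ : ℝ≥0) (s D : Fin (m + 1) → ℝ) : ℝ :=
  -(1 / 2) * Real.log (((σ : ℝ) ^ 2)⁻¹ + s 0) - (1 / 2) * Real.log (V σ s D (Fin.last m))
    - (1 / 2) * ∑ i : Fin m, Real.log (1 + (s i.succ - s i.castSucc) * V σ s D i.castSucc)

end HeegardBerger

end

open MeasureTheory ProbabilityTheory InformationTheory
open scoped ENNReal NNReal

noncomputable section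

namespace HeegardBerger


/-! ### Divergence, mutual information and the chain rule -/

section InformationTheory

variable {Ω 𝒳 𝒲 𝒵 α β : Type} [MeasurableSpace Ω] [MeasurableSpace 𝒳] [MeasurableSpace 𝒲]
  [MeasurableSpace 𝒵] [MeasurableSpace α] [MeasurableSpace β]

/-! Converse. Follow the information about `X` available to successive decoders. Passing from `(Y_i,
W_1^{i-1})` to `(Y_i, W_1^i)` raises it by at most the i-th rate (chain rule,
`mutualInfo_obsLE_le`). Passing from `Y_i` to `Y_{i+1}` with the same layers raises it by at most ½
log(1 + (s_{i+1} - s_i) V_i) (`mutualInfo_le_of_isSideInfo`). It starts at no more than ½ log(1 +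
s_1 σ²) and must end at no less than ½ log(σ² / V_M) (`le_mutualInfo_of_gaussian`). Comparing the
two ends bounds the sum of the rates from below by the formula.

What makes this work for every admissible `W` is that `V_i` always bounds the achievable error at
decoder i (`IsAdmissible.exists_estimator`). Either the distortion constraint gives it, or the
previous estimator is improved by the better side information. Both uses of better side information
rest on one coupling: in law, `Y_{i+1}` is a linear combination of `Y_i` and an independent Gaussian
observation of `X` with gain √(s_{i+1} - s_i).

Two variational estimates replace any use of differential entropy. A Gaussian reference kernel
bounds conditional information from above (`condMutualInfo_add_noise_le`), and a Gaussian test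
function in the Donsker–Varadhan inequality bounds mutual information from below.

Achievability. For `W_i = a_i X + N_i` precisions add, so the linear estimator has error exactly
`V_i`, independent of the observations. The upper estimate bounds each rate by ½ log(`priorV` /
`V`), and these bounds telescope to the formula. The converse then forces equality in the sum, hence
in every layer.

Existence. Writing `Y_i / √s_i` as `X` plus a tail of independent noises with variances 1/s_j -
1/s_{j+1} produces a degraded chain with the right marginals. -/

theorem klDiv_map_measurableEquiv (e : α ≃ᵐ β) (μ ν : Measure α) [IsFiniteMeasure μ]
    [IsFiniteMeasure ν] : klDiv (μ.map e) (ν.map e) = klDiv μ ν := by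
  refine le_antisymm (klDiv_map_le μ ν e.measurable) ?_
  have h := klDiv_map_le (μ.map e) (ν.map e) e.symm.measurable
  simpa [Measure.map_map e.symm.measurable e.measurable] using h

/-- The rearrangement `(z, x, w) ↦ ((z, x), w)`. -/
abbrev equivLeft : 𝒵 × 𝒳 × 𝒲 ≃ᵐ (𝒵 × 𝒳) × 𝒲 := MeasurableEquiv.prodAssoc.symm

/-- The rearrangement `(z, x, w) ↦ ((z, w), x)`. -/
abbrev equivRight : 𝒵 × 𝒳 × 𝒲 ≃ᵐ (𝒵 × 𝒲) × 𝒳 :=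
  (MeasurableEquiv.prodCongr (MeasurableEquiv.refl 𝒵) MeasurableEquiv.prodComm).trans
    MeasurableEquiv.prodAssoc.symm

theorem map_equivLeft_compProd_prod (ν : Measure 𝒵) [IsFiniteMeasure ν] (κ : Kernel 𝒵 𝒳)
    [IsMarkovKernel κ] (η : Kernel 𝒵 𝒲) [IsMarkovKernel η] :
    (ν ⊗ₘ (κ ×ₖ η)).map equivLeft = (ν ⊗ₘ κ) ⊗ₘ η.prodMkRight 𝒳 := by
  refine Measure.ext_of_lintegral _ fun f hf => ?_
  rw [lintegral_map hf (MeasurableEquiv.measurable _),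
    Measure.lintegral_compProd (f := fun a => f (equivLeft a))
      (hf.comp (MeasurableEquiv.measurable _)),
    Measure.lintegral_compProd hf,
    Measure.lintegral_compProd (f := fun p => ∫⁻ w, f (p, w) ∂(η.prodMkRight 𝒳 p))
      (Measurable.lintegral_kernel_prod_right hf)]
  refine lintegral_congr fun z => ?_
  rw [Kernel.prod_apply, lintegral_prod]
  · rfl
  · exact (hf.comp ((MeasurableEquiv.measurable _).comp measurable_prodMk_left)).aemeasurable

theorem map_equivRight_compProd_prod (ν : Measure 𝒵) [IsFiniteMeasure ν] (κ : Kernel 𝒵 𝒳)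
    [IsMarkovKernel κ] (η : Kernel 𝒵 𝒲) [IsMarkovKernel η] :
    (ν ⊗ₘ (κ ×ₖ η)).map equivRight = (ν ⊗ₘ η) ⊗ₘ κ.prodMkRight 𝒲 := by
  refine Measure.ext_of_lintegral _ fun f hf => ?_
  rw [lintegral_map hf (MeasurableEquiv.measurable _),
    Measure.lintegral_compProd (f := fun a => f (equivRight a))
      (hf.comp (MeasurableEquiv.measurable _)),
    Measure.lintegral_compProd hf,
    Measure.lintegral_compProd (f := fun p => ∫⁻ x, f (p, x) ∂(κ.prodMkRight 𝒲 p))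
      (Measurable.lintegral_kernel_prod_right hf)]
  refine lintegral_congr fun z => ?_
  rw [Kernel.prod_apply, lintegral_prod_symm]
  · rfl
  · exact (hf.comp ((MeasurableEquiv.measurable _).comp measurable_prodMk_left)).aemeasurable

/-- Given `z` the two kernels do not see one another, so they may be attached in either order. This
exchange lets the divergence chain rule be applied with either `X` or `W` as the last variable. -/
theorem map_equivRight_symm_compProd (ν : Measure 𝒵) [IsFiniteMeasure ν] (κ : Kernel 𝒵 𝒳)
    [IsMarkovKernel κ] (η : Kernel 𝒵 𝒲) [IsMarkovKernel η] :
    ((ν ⊗ₘ η) ⊗ₘ κ.prodMkRight 𝒲).map (equivRight.symm.trans equivLeft)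
      = (ν ⊗ₘ κ) ⊗ₘ η.prodMkRight 𝒳 := by
  rw [← map_equivLeft_compProd_prod, ← map_equivRight_compProd_prod,
    Measure.map_map (MeasurableEquiv.measurable _) (MeasurableEquiv.measurable _)]
  congr 1

/-- Mutual information `I(X; U)` in nats. -/
def mutualInfo (X : Ω → 𝒳) (U : Ω → 𝒵) (μ : Measure Ω) : ℝ≥0∞ :=
  klDiv (μ.map (fun ω => (U ω, X ω))) ((μ.map U).prod (μ.map X))

theorem mutualInfo_congr_law {Ω' : Type} [MeasurableSpace Ω'] {μ : Measure Ω}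
    {μ' : Measure Ω'}
    {X : Ω → 𝒳} {U : Ω → 𝒵} (hX : Measurable X) (hU : Measurable U)
    {X' : Ω' → 𝒳} {U' : Ω' → 𝒵} (hX' : Measurable X') (hU' : Measurable U')
    (h : μ.map (fun ω => (U ω, X ω)) = μ'.map (fun ω => (U' ω, X' ω))) :
    mutualInfo X U μ = mutualInfo X' U' μ' := by
  have h1 := congrArg (fun m => m.map Prod.fst) h
  have h2 := congrArg (fun m => m.map Prod.snd) h
  rw [Measure.map_map (by fun_prop) (by fun_prop), Measure.map_map (by fun_prop) (by fun_prop)]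
    at h1 h2
  have h1' : μ.map U = μ'.map U' := h1
  have h2' : μ.map X = μ'.map X' := h2
  rw [mutualInfo, mutualInfo, h, h1', h2']

variable {μ : Measure Ω} [IsProbabilityMeasure μ]

/-- Data processing: `Prod.map f id` carries the joint law to the joint law and the product of
marginals to the product of marginals. -/
theorem mutualInfo_comp_le {X : Ω → 𝒳} {U : Ω → 𝒵} (hX : Measurable X) (hU : Measurable U)
    {f : 𝒵 → α} (hf : Measurable f) :
    mutualInfo X (fun ω => f (U ω)) μ ≤ mutualInfo X U μ := by
  have := Measure.isProbabilityMeasure_map (μ := μ) hX.aemeasurable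
  have := Measure.isProbabilityMeasure_map (μ := μ) hU.aemeasurable
  have := Measure.isProbabilityMeasure_map (μ := μ) (hU.prodMk hX).aemeasurable
  have h := klDiv_map_le (μ.map (fun ω => (U ω, X ω))) ((μ.map U).prod (μ.map X))
    (g := Prod.map f id) (by fun_prop)
  rw [Measure.map_map (by fun_prop) (by fun_prop), ← Measure.map_prod_map _ _ hf measurable_id,
    Measure.map_id, Measure.map_map hf hU] at h
  exact h

variable [StandardBorelSpace 𝒳] [Nonempty 𝒳] [StandardBorelSpace 𝒲] [Nonempty 𝒲]

theorem condMutualInfo_eq_klDiv_left {X : Ω → 𝒳} {W : Ω → 𝒲} {Z : Ω → 𝒵} (hX : Measurable X)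
    (hW : Measurable W) (hZ : Measurable Z) :
    condMutualInfo X W Z μ = klDiv (μ.map (fun ω => ((Z ω, X ω), W ω)))
      (μ.map (fun ω => (Z ω, X ω)) ⊗ₘ (condDistrib W Z μ).prodMkRight 𝒳) := by
  rw [condMutualInfo, ← klDiv_map_measurableEquiv equivLeft, map_equivLeft_compProd_prod,
    Measure.map_map (MeasurableEquiv.measurable _) (by fun_prop),
    compProd_map_condDistrib hX.aemeasurable]
  rfl

theorem condMutualInfo_eq_klDiv_right {X : Ω → 𝒳} {W : Ω → 𝒲} {Z : Ω → 𝒵} (hX : Measurable X)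
    (hW : Measurable W) (hZ : Measurable Z) :
    condMutualInfo X W Z μ = klDiv (μ.map (fun ω => ((Z ω, W ω), X ω)))
      (μ.map (fun ω => (Z ω, W ω)) ⊗ₘ (condDistrib X Z μ).prodMkRight 𝒲) := by
  rw [condMutualInfo, ← klDiv_map_measurableEquiv equivRight, map_equivRight_compProd_prod,
    Measure.map_map (MeasurableEquiv.measurable _) (by fun_prop),
    compProd_map_condDistrib hW.aemeasurable]
  rfl

/-- Chain rule `I(X; Z, W) = I(X; Z) + I(X; W | Z)`. -/
theorem mutualInfo_prodMk {X : Ω → 𝒳} {W : Ω → 𝒲} {Z : Ω → 𝒵} (hX : Measurable X)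
    (hW : Measurable W) (hZ : Measurable Z) :
    mutualInfo X (fun ω => (Z ω, W ω)) μ = mutualInfo X Z μ + condMutualInfo X W Z μ := by
  have := Measure.isProbabilityMeasure_map (μ := μ) hX.aemeasurable
  have := Measure.isProbabilityMeasure_map (μ := μ) hZ.aemeasurable
  rw [condMutualInfo_eq_klDiv_left hX hW hZ, mutualInfo, mutualInfo]
  have h1 : μ.map (fun ω => ((Z ω, X ω), W ω)) =
      μ.map (fun ω => (Z ω, X ω)) ⊗ₘ condDistrib W (fun ω => (Z ω, X ω)) μ :=
    (compProd_map_condDistrib hW.aemeasurable).symm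
  rw [h1, ← klDiv_compProd_eq_add, ← h1, ← klDiv_map_measurableEquiv
    ((equivRight (𝒵 := 𝒵) (𝒳 := 𝒳) (𝒲 := 𝒲)).symm.trans equivLeft),
    Measure.map_map (MeasurableEquiv.measurable _) (by fun_prop)]
  -- A product with the law of `X` is a composition with a constant kernel, so the exchange of
  -- kernels applies to it.
  have h2 : (μ.map (fun ω => (Z ω, W ω))).prod (μ.map X) =
      (μ.map Z ⊗ₘ condDistrib W Z μ) ⊗ₘ (Kernel.const 𝒵 (μ.map X)).prodMkRight 𝒲 := by
    rw [compProd_map_condDistrib hW.aemeasurable, ← Measure.compProd_const]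
    rfl
  rw [h2, map_equivRight_symm_compProd, Measure.compProd_const]
  rfl

/-- Replacing the conditional law of `W` by any other kernel increases the divergence. -/
theorem condMutualInfo_le_klDiv {X : Ω → 𝒳} {W : Ω → 𝒲} {Z : Ω → 𝒵} (hX : Measurable X)
    (hW : Measurable W) (hZ : Measurable Z) (R : Kernel 𝒵 𝒲) [IsMarkovKernel R] :
    condMutualInfo X W Z μ ≤ klDiv (μ.map (fun ω => ((Z ω, X ω), W ω)))
      (μ.map (fun ω => (Z ω, X ω)) ⊗ₘ R.prodMkRight 𝒳) := by
  have := Measure.isProbabilityMeasure_map (μ := μ) hZ.aemeasurable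
  have h1 : μ.map (fun ω => ((Z ω, W ω), X ω)) =
      μ.map (fun ω => (Z ω, W ω)) ⊗ₘ condDistrib X (fun ω => (Z ω, W ω)) μ :=
    (compProd_map_condDistrib hX.aemeasurable).symm
  -- Regrouped with `X` last, the reference measure keeps the kernel of `X` given `Z`, and only its
  -- base changes with `R`. The chain rule then splits the divergence into the conditional
  -- information and the nonnegative divergence of the law of `(Z, W)` from the base.
  have h2 : klDiv (μ.map (fun ω => ((Z ω, X ω), W ω)))
      (μ.map (fun ω => (Z ω, X ω)) ⊗ₘ R.prodMkRight 𝒳) =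
      klDiv (μ.map (fun ω => ((Z ω, W ω), X ω)))
        ((μ.map Z ⊗ₘ R) ⊗ₘ (condDistrib X Z μ).prodMkRight 𝒲) := by
    rw [← klDiv_map_measurableEquiv
      ((equivRight (𝒵 := 𝒵) (𝒳 := 𝒳) (𝒲 := 𝒲)).symm.trans equivLeft) (μ.map _),
      map_equivRight_symm_compProd, compProd_map_condDistrib hX.aemeasurable,
      Measure.map_map (MeasurableEquiv.measurable _) (by fun_prop)]
    rfl
  rw [condMutualInfo_eq_klDiv_right hX hW hZ, h2, h1,
    klDiv_compProd_eq_add (ν := μ.map Z ⊗ₘ R)]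
  exact le_add_left le_rfl

end InformationTheory

/-! ### Conditional independence expressed through laws -/

section CondIndep

variable {Ω Ω' 𝒰 𝒱 𝒲 𝒵 : Type} [MeasurableSpace Ω] [StandardBorelSpace Ω]
  [MeasurableSpace Ω'] [StandardBorelSpace Ω']
  [MeasurableSpace 𝒰] [StandardBorelSpace 𝒰] [Nonempty 𝒰] [MeasurableSpace 𝒱]
  [StandardBorelSpace 𝒱] [Nonempty 𝒱] [MeasurableSpace 𝒲] [StandardBorelSpace 𝒲] [Nonempty 𝒲]
  [MeasurableSpace 𝒵] {μ : Measure Ω} [IsProbabilityMeasure μ]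
  {μ' : Measure Ω'} [IsProbabilityMeasure μ']

theorem condIndepFun_iff_map_eq_compProd {f : Ω → 𝒰} {g : Ω → 𝒱} {k : Ω → 𝒵} (hf : Measurable f)
    (hg : Measurable g) (hk : Measurable k) :
    CondIndepFun (MeasurableSpace.comap k inferInstance) hk.comap_le g f μ ↔
      μ.map (fun ω => ((k ω, g ω), f ω)) =
        μ.map (fun ω => (k ω, g ω)) ⊗ₘ (condDistrib f k μ).prodMkRight 𝒱 := by
  rw [condIndepFun_iff_condDistrib_prod_ae_eq_prodMkRight hf hg hk,
    condDistrib_ae_eq_iff_measure_eq_compProd _ hf.aemeasurable]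

/-- The factorization criterion involves only the joint law, so Markov chains can be moved between
`Q` and any space carrying variables of law `Q`. -/
theorem condIndepFun_iff_of_law_eq {f : Ω → 𝒰} {g : Ω → 𝒱} {k : Ω → 𝒵} (hf : Measurable f)
    (hg : Measurable g) (hk : Measurable k) {f' : Ω' → 𝒰} {g' : Ω' → 𝒱} {k' : Ω' → 𝒵}
    (hf' : Measurable f') (hg' : Measurable g') (hk' : Measurable k')
    (h : μ.map (fun ω => ((k ω, g ω), f ω)) = μ'.map (fun ω => ((k' ω, g' ω), f' ω))) :
    CondIndepFun (MeasurableSpace.comap k inferInstance) hk.comap_le g f μ ↔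
      CondIndepFun (MeasurableSpace.comap k' inferInstance) hk'.comap_le g' f' μ' := by
  have h1 := congrArg (fun m => m.map Prod.fst) h
  have h2 := congrArg (fun m => m.map (fun p : (𝒵 × 𝒱) × 𝒰 => (p.1.1, p.2))) h
  rw [Measure.map_map (by fun_prop) (by fun_prop), Measure.map_map (by fun_prop) (by fun_prop)]
    at h1 h2
  have h1' : μ.map (fun ω => (k ω, g ω)) = μ'.map (fun ω => (k' ω, g' ω)) := h1
  have h2' : μ.map (fun ω => (k ω, f ω)) = μ'.map (fun ω => (k' ω, f' ω)) := h2
  have h3 : condDistrib f k μ = condDistrib f' k' μ' := by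
    simp only [condDistrib, h2']
  rw [condIndepFun_iff_map_eq_compProd hf hg hk, condIndepFun_iff_map_eq_compProd hf' hg' hk',
    h, h1', h3]

/-- Independent noise may be adjoined to one side of a conditional independence. -/
theorem CondIndepFun.prodMk_of_indepFun {f : Ω → 𝒰} {g : Ω → 𝒱} {k : Ω → 𝒵} {n : Ω → 𝒲}
    (hf : Measurable f) (hg : Measurable g) (hk : Measurable k) (hn : Measurable n)
    (h : CondIndepFun (MeasurableSpace.comap k inferInstance) hk.comap_le g f μ)
    (hind : IndepFun n (fun ω => ((k ω, g ω), f ω)) μ) :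
    CondIndepFun (MeasurableSpace.comap k inferInstance) hk.comap_le
      (fun ω => (g ω, n ω)) f μ := by
  rw [condIndepFun_iff_map_eq_compProd hf hg hk] at h
  rw [condIndepFun_iff_map_eq_compProd hf (by fun_prop) hk]
  have hind' : IndepFun n (fun ω => (k ω, g ω)) μ := hind.comp measurable_id measurable_fst
  rw [indepFun_iff_map_prod_eq_prod_map_map (by fun_prop) (by fun_prop)] at hind hind'
  have := Measure.isProbabilityMeasure_map (μ := μ) hn.aemeasurable
  have e1 : μ.map (fun ω => ((k ω, g ω, n ω), f ω)) =
      ((μ.map n).prod (μ.map (fun ω => ((k ω, g ω), f ω)))).map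
        (fun p => ((p.2.1.1, p.2.1.2, p.1), p.2.2)) := by
    rw [← hind, Measure.map_map (by fun_prop) (by fun_prop)]
    rfl
  have e2 : μ.map (fun ω => (k ω, g ω, n ω)) =
      ((μ.map n).prod (μ.map (fun ω => (k ω, g ω)))).map (fun p => (p.2.1, p.2.2, p.1)) := by
    rw [← hind', Measure.map_map (by fun_prop) (by fun_prop)]
    rfl
  rw [e1, e2, h]
  -- The noise is integrated outermost; for each fixed value of it the remaining identity is the
  -- original factorization.
  refine Measure.ext_of_lintegral _ fun F hF => ?_
  have hG : Measurable fun p : 𝒵 × 𝒱 × 𝒲 =>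
      ∫⁻ b, F (p, b) ∂((condDistrib f k μ).prodMkRight (𝒱 × 𝒲) p) :=
    Measurable.lintegral_kernel_prod_right hF
  have hG' : Measurable fun p : 𝒲 × 𝒵 × 𝒱 => ∫⁻ b, F ((p.2.1, p.2.2, p.1), b)
      ∂((condDistrib f k μ).prodMkRight (𝒱 × 𝒲) (p.2.1, p.2.2, p.1)) :=
    hG.comp (g := fun p : 𝒵 × 𝒱 × 𝒲 =>
      ∫⁻ b, F (p, b) ∂((condDistrib f k μ).prodMkRight (𝒱 × 𝒲) p)) (by fun_prop)
  rw [lintegral_map hF (by fun_prop), Measure.lintegral_compProd hF,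
    lintegral_map hG (by fun_prop), lintegral_prod _ (by fun_prop),
    lintegral_prod _ hG'.aemeasurable]
  refine lintegral_congr fun a => ?_
  rw [Measure.lintegral_compProd (by fun_prop)]
  rfl

end CondIndep

/-! ### Gaussian channels: an upper and a lower estimate of information -/

section Gaussian

variable {Ω 𝒯 𝒵 : Type} [MeasurableSpace Ω] [MeasurableSpace 𝒯] [MeasurableSpace 𝒵]

/-- The Gaussian channel `t ↦ N(f t, τ)`. -/
def gaussianKernel (f : 𝒯 → ℝ) (hf : Measurable f) (τ : ℝ≥0) : Kernel 𝒯 ℝ where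
  toFun t := gaussianReal (f t) τ
  measurable' := measurable_gaussianReal.comp (hf.prodMk measurable_const)

theorem gaussianKernel_apply (f : 𝒯 → ℝ) (hf : Measurable f) (τ : ℝ≥0) (t : 𝒯) :
    gaussianKernel f hf τ t = gaussianReal (f t) τ := rfl

instance (f : 𝒯 → ℝ) (hf : Measurable f) (τ : ℝ≥0) : IsMarkovKernel (gaussianKernel f hf τ) :=
  ⟨fun t => by rw [gaussianKernel_apply]; infer_instance⟩

theorem moments_of_map_eq_gaussianReal {μ : Measure Ω} {N : Ω → ℝ} (hN : Measurable N) {v : ℝ≥0}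
    (hlaw : μ.map N = gaussianReal 0 v) :
    MemLp N 2 μ ∧ ∫ ω, N ω ∂μ = 0 ∧ ∫ ω, N ω ^ 2 ∂μ = v := by
  have hL : HasLaw N (gaussianReal 0 v) μ := ⟨hN.aemeasurable, hlaw⟩
  have h1 : ∫ ω, N ω ∂μ = 0 := by rw [hL.integral_eq, integral_id_gaussianReal]
  have h2 : MemLp N 2 μ := by
    have := memLp_id_gaussianReal' (μ := 0) (v := v) 2 (by simp)
    rw [← hlaw, memLp_map_measure_iff (by fun_prop) hN.aemeasurable] at this
    exact this
  refine ⟨h2, h1, ?_⟩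
  rw [← variance_of_integral_eq_zero hN.aemeasurable h1, hL.variance_eq, variance_id_gaussianReal]

theorem memLp_of_lintegral_sq_le {μ : Measure Ω} {E : Ω → ℝ} (hE : Measurable E) {v : ℝ} (hv : 0 ≤ v)
    (h : ∫⁻ ω, ENNReal.ofReal (E ω ^ 2) ∂μ ≤ ENNReal.ofReal v) :
    MemLp E 2 μ ∧ ∫ ω, E ω ^ 2 ∂μ ≤ v := by
  have hint : Integrable (fun ω => E ω ^ 2) μ :=
    ⟨by fun_prop, by
      rw [hasFiniteIntegral_iff_ofReal (ae_of_all _ fun ω => sq_nonneg _)]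
      exact h.trans_lt ENNReal.ofReal_lt_top⟩
  refine ⟨(memLp_two_iff_integrable_sq hE.aestronglyMeasurable).2 hint, ?_⟩
  rw [← ofReal_integral_eq_lintegral_ofReal hint (ae_of_all _ fun ω => sq_nonneg _)] at h
  exact (ENNReal.ofReal_le_ofReal_iff hv).1 h

variable {μ : Measure Ω} [IsProbabilityMeasure μ]

theorem lintegral_gaussianReal_eq_shift (m : ℝ) (F : ℝ → ℝ≥0∞) (hF : Measurable F) (τ : ℝ≥0) :
    ∫⁻ w, F w ∂(gaussianReal m τ) = ∫⁻ n, F (m + n) ∂(gaussianReal 0 τ) := by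
  have h := gaussianReal_map_const_add (μ := 0) (v := τ) m
  rw [zero_add] at h
  rw [← h, lintegral_map hF (by fun_prop)]

/-- The law of `(T, f(T) + N)` for Gaussian `N` independent of `T`. -/
theorem map_add_noise {T : Ω → 𝒯} {N : Ω → ℝ} (hT : Measurable T) (hN : Measurable N) {τ : ℝ≥0}
    (hlaw : μ.map N = gaussianReal 0 τ) (hind : IndepFun N T μ) {f : 𝒯 → ℝ} (hf : Measurable f) :
    μ.map (fun ω => (T ω, f (T ω) + N ω)) = μ.map T ⊗ₘ gaussianKernel f hf τ := by
  have := Measure.isProbabilityMeasure_map (μ := μ) hT.aemeasurable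
  have h := (indepFun_iff_map_prod_eq_prod_map_map (by fun_prop) (by fun_prop)).1 hind.symm
  have e : μ.map (fun ω => (T ω, f (T ω) + N ω)) =
      ((μ.map T).prod (gaussianReal 0 τ)).map (fun p => (p.1, f p.1 + p.2)) := by
    rw [← hlaw, ← h, Measure.map_map (by fun_prop) (by fun_prop)]
    rfl
  rw [e]
  refine Measure.ext_of_lintegral _ fun F hF => ?_
  rw [lintegral_map hF (by fun_prop), lintegral_prod _ (by fun_prop),
    Measure.lintegral_compProd hF]
  refine lintegral_congr fun t => ?_
  rw [gaussianKernel_apply,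
    lintegral_gaussianReal_eq_shift (f t) (fun w => F (t, w)) (by fun_prop)]

/-- The density of `N(m, 1)` with respect to `N(m', τ)`. -/
def gaussianRatio (m m' : ℝ) (τ : ℝ≥0) (w : ℝ) : ℝ≥0∞ :=
  gaussianPDF m 1 w / gaussianPDF m' τ w

theorem measurable_gaussianRatio {f g w : 𝒯 → ℝ} (hf : Measurable f) (hg : Measurable g)
    (hw : Measurable w) (τ : ℝ≥0) : Measurable fun t => gaussianRatio (f t) (g t) τ (w t) := by
  unfold gaussianRatio
  have h := measurable_uncurry_gaussianPDF
  exact (h.comp (hf.prodMk (measurable_const.prodMk hw))).div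
    (h.comp (hg.prodMk (measurable_const.prodMk hw)))

theorem log_gaussianPDFReal (m x : ℝ) {v : ℝ≥0} (hv : v ≠ 0) :
    Real.log (gaussianPDFReal m v x) =
      -(1 / 2) * Real.log (2 * Real.pi * v) - (x - m) ^ 2 / (2 * v) := by
  have hv' : (0 : ℝ) < v := by positivity
  rw [gaussianPDFReal_def, Real.log_mul (by positivity) (by positivity), Real.log_exp,
    Real.log_inv, Real.log_sqrt (by positivity)]
  ring

theorem log_gaussianRatio (m m' w : ℝ) {τ : ℝ≥0} (hτ : τ ≠ 0) :
    Real.log (gaussianRatio m m' τ w).toReal =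
      1 / 2 * Real.log τ - (w - m) ^ 2 / 2 + (w - m') ^ 2 / (2 * τ) := by
  have hτ' : (0 : ℝ) < τ := by positivity
  rw [gaussianRatio, ENNReal.toReal_div, toReal_gaussianPDF, toReal_gaussianPDF,
    Real.log_div (gaussianPDFReal_pos _ _ _ one_ne_zero).ne' (gaussianPDFReal_pos _ _ _ hτ).ne',
    log_gaussianPDFReal _ _ one_ne_zero, log_gaussianPDFReal _ _ hτ,
    Real.log_mul (by positivity) hτ'.ne']
  simp
  ring

/-- The base measure is common, so the density is the ratio of the Gaussian densities fibre by
fibre. -/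
theorem compProd_gaussianKernel_eq_withDensity (P : Measure 𝒯) [IsProbabilityMeasure P]
    {f g : 𝒯 → ℝ} (hf : Measurable f) (hg : Measurable g) {τ : ℝ≥0} (hτ : τ ≠ 0) :
    P ⊗ₘ gaussianKernel f hf 1 = (P ⊗ₘ gaussianKernel g hg τ).withDensity
      (fun p => gaussianRatio (f p.1) (g p.1) τ p.2) := by
  have hρ : Measurable fun p : 𝒯 × ℝ => gaussianRatio (f p.1) (g p.1) τ p.2 :=
    measurable_gaussianRatio (by fun_prop) (by fun_prop) (by fun_prop) τ
  refine Measure.ext_of_lintegral _ fun F hF => ?_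
  rw [lintegral_withDensity_eq_lintegral_mul _ hρ hF, Measure.lintegral_compProd hF,
    Measure.lintegral_compProd (hρ.mul hF)]
  refine lintegral_congr fun t => ?_
  have hρt : Measurable fun w => gaussianRatio (f t) (g t) τ w :=
    measurable_gaussianRatio measurable_const measurable_const measurable_id τ
  rw [gaussianKernel_apply, gaussianKernel_apply, gaussianReal_of_var_ne_zero _ one_ne_zero,
    gaussianReal_of_var_ne_zero _ hτ,
    lintegral_withDensity_eq_lintegral_mul _ (measurable_gaussianPDF _ _) (by fun_prop)]
  simp only [Pi.mul_apply]
  rw [lintegral_withDensity_eq_lintegral_mul _ (measurable_gaussianPDF _ _)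
      (g := fun b => gaussianRatio (f t) (g t) τ b * F (t, b)) (by fun_prop)]
  refine lintegral_congr fun w => ?_
  simp only [Pi.mul_apply, gaussianRatio]
  rw [← mul_assoc, ENNReal.mul_div_cancel (gaussianPDF_pos _ hτ _).ne' gaussianPDF_ne_top]

/-- The log density evaluated at `f(T) + N` is a quadratic polynomial in `N` and `f(T) - g(T)`. Its
cross term has mean zero because `N` is centred and independent of `T`. -/
theorem klDiv_add_noise_le {T : Ω → 𝒯} {N : Ω → ℝ} (hT : Measurable T) (hN : Measurable N)
    (hlaw : μ.map N = gaussianReal 0 1) (hind : IndepFun N T μ) {f g : 𝒯 → ℝ}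
    (hf : Measurable f) (hg : Measurable g) {τ : ℝ≥0} (hτ : τ ≠ 0)
    (hD : MemLp (fun ω => f (T ω) - g (T ω)) 2 μ) :
    klDiv (μ.map (fun ω => (T ω, f (T ω) + N ω))) (μ.map T ⊗ₘ gaussianKernel g hg τ) =
      ENNReal.ofReal (1 / 2 * Real.log τ - 1 / 2
        + (1 + ∫ ω, (f (T ω) - g (T ω)) ^ 2 ∂μ) / (2 * τ)) := by
  have := Measure.isProbabilityMeasure_map (μ := μ) hT.aemeasurable
  obtain ⟨hN2, hN0, hN1⟩ := moments_of_map_eq_gaussianReal hN hlaw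
  set D : Ω → ℝ := fun ω => f (T ω) - g (T ω) with hDdef
  set P := μ.map (fun ω => (T ω, f (T ω) + N ω)) with hP
  set ν := μ.map T ⊗ₘ gaussianKernel g hg τ with hν
  have hPprob : IsProbabilityMeasure P := Measure.isProbabilityMeasure_map (by fun_prop)
  set ρ : 𝒯 × ℝ → ℝ≥0∞ := fun p => gaussianRatio (f p.1) (g p.1) τ p.2 with hρdef
  have hρ : Measurable ρ :=
    measurable_gaussianRatio (by fun_prop) (by fun_prop) (by fun_prop) τ
  have hPν : P = ν.withDensity ρ := by
    rw [hP, map_add_noise hT hN hlaw hind hf, compProd_gaussianKernel_eq_withDensity _ hf hg hτ]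
  have hac : P ≪ ν := hPν ▸ withDensity_absolutelyContinuous ν ρ
  have hllr : llr P ν =ᵐ[P] fun p => Real.log (ρ p).toReal := by
    refine hac.ae_le ?_
    have h := Measure.rnDeriv_withDensity ν hρ
    rw [← hPν] at h
    filter_upwards [h] with p hp
    rw [llr, hp]
  have hlog : (fun ω => Real.log (ρ (T ω, f (T ω) + N ω)).toReal) = fun ω =>
      1 / 2 * Real.log τ - N ω ^ 2 / 2 + (D ω ^ 2 + 2 * (N ω * D ω) + N ω ^ 2) / (2 * τ) := by
    funext ω
    rw [hρdef, log_gaussianRatio _ _ _ hτ, hDdef]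
    ring
  have hND : IndepFun N D μ :=
    hind.comp measurable_id (φ := id) (ψ := fun t => f t - g t) (by fun_prop)
  have i1 : Integrable (fun ω => N ω ^ 2) μ := hN2.integrable_sq
  have i2 : Integrable (fun ω => D ω ^ 2) μ := hD.integrable_sq
  have i3 : Integrable (fun ω => N ω * D ω) μ :=
    hND.integrable_mul (hN2.integrable one_le_two) (hD.integrable one_le_two)
  have hint : Integrable (fun ω => Real.log (ρ (T ω, f (T ω) + N ω)).toReal) μ := by
    rw [hlog]
    fun_prop
  have hmeas : AEStronglyMeasurable (fun p => Real.log (ρ p).toReal) P :=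
    (Real.measurable_log.comp hρ.ennreal_toReal).aestronglyMeasurable
  have hintP : Integrable (llr P ν) P := by
    rw [integrable_congr hllr, hP, integrable_map_measure hmeas (by fun_prop)]
    exact hint
  rw [klDiv_of_ac_of_integrable hac hintP, integral_congr_ae hllr, hP,
    integral_map (by fun_prop) hmeas, hlog]
  congr 1
  have e3 : ∫ ω, 2 * (N ω * D ω) ∂μ = 0 := by
    rw [integral_const_mul, hND.integral_fun_mul_eq_mul_integral hN2.aestronglyMeasurable hD.aestronglyMeasurable, hN0,
      zero_mul, mul_zero]
  rw [integral_add (by fun_prop) (by fun_prop), integral_sub (by fun_prop) (by fun_prop),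
    integral_div, integral_div, integral_add (by fun_prop) (by fun_prop),
    integral_add (by fun_prop) (by fun_prop), e3, hN1]
  simp
  ring

/-- A Gaussian observation of `X` with gain `a` carries at most `½ log (1 + a² v)` nats when `X`
is already known up to mean squared error `v`. -/
theorem condMutualInfo_add_noise_le {X N : Ω → ℝ} {Z : Ω → 𝒵} (hX : Measurable X)
    (hN : Measurable N) (hZ : Measurable Z) (hlaw : μ.map N = gaussianReal 0 1)
    (hind : IndepFun N (fun ω => (Z ω, X ω)) μ) (a : ℝ) {φ : 𝒵 → ℝ} (hφ : Measurable φ) {v : ℝ}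
    (hv : 0 ≤ v) (herr : ∫⁻ ω, ENNReal.ofReal ((X ω - φ (Z ω)) ^ 2) ∂μ ≤ ENNReal.ofReal v) :
    condMutualInfo X (fun ω => a * X ω + N ω) Z μ ≤
      ENNReal.ofReal (1 / 2 * Real.log (1 + a ^ 2 * v)) := by
  obtain ⟨hmem, hle⟩ := memLp_of_lintegral_sq_le (μ := μ) (by fun_prop) hv herr
  -- The reference channel predicts `a X + N` by `N(a φ(Z), τ)`. This variance bounds the mean
  -- squared prediction error, so the quadratic term below is at most 1/2 and only ½ log τ survives.
  set τ : ℝ≥0 := ⟨1 + a ^ 2 * v, by positivity⟩ with hτdef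
  have hτ' : (τ : ℝ) = 1 + a ^ 2 * v := rfl
  have hτpos : (0 : ℝ) < τ := by rw [hτ']; positivity
  have hτ : τ ≠ 0 := by
    rintro h
    rw [h] at hτpos
    simp at hτpos
  have hg : Measurable fun z : 𝒵 => a * φ z := by fun_prop
  refine (condMutualInfo_le_klDiv hX (by fun_prop) hZ (gaussianKernel _ hg τ)).trans ?_
  have h := klDiv_add_noise_le (μ := μ) (T := fun ω => (Z ω, X ω)) (by fun_prop) hN hlaw hind
    (f := fun p => a * p.2) (g := fun p => a * φ p.1) (by fun_prop) (by fun_prop) hτ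
    (by simpa only [← mul_sub] using hmem.const_mul a)
  refine (le_of_eq h).trans (ENNReal.ofReal_le_ofReal ?_)
  have e : ∫ ω, (a * X ω - a * φ (Z ω)) ^ 2 ∂μ = a ^ 2 * ∫ ω, (X ω - φ (Z ω)) ^ 2 ∂μ := by
    rw [← integral_const_mul]
    congr 1
    funext ω
    ring
  have hq : (1 + a ^ 2 * ∫ ω, (X ω - φ (Z ω)) ^ 2 ∂μ) / (2 * τ) ≤ 1 / 2 := by
    rw [div_le_div_iff₀ (by positivity) (by norm_num), hτ']
    nlinarith [mul_le_mul_of_nonneg_left hle (sq_nonneg a)]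
  simp only [e]
  rw [hτ'] at hq ⊢
  linarith

/-- Lower bound of Shannon type: estimating a Gaussian source of variance `v₀` with mean squared
error `v` takes `½ log (v₀ / v)` nats. -/
theorem le_mutualInfo_of_gaussian {X : Ω → ℝ} {U : Ω → 𝒵} (hX : Measurable X) (hU : Measurable U)
    {v₀ : ℝ≥0} (hv₀ : v₀ ≠ 0) (hlaw : μ.map X = gaussianReal 0 v₀) {φ : 𝒵 → ℝ}
    (hφ : Measurable φ) {v : ℝ} (hv : 0 < v)
    (herr : ∫⁻ ω, ENNReal.ofReal ((X ω - φ (U ω)) ^ 2) ∂μ ≤ ENNReal.ofReal v) :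
    ENNReal.ofReal (1 / 2 * Real.log (v₀ / v)) ≤ mutualInfo X U μ := by
  obtain ⟨hmem, hle⟩ := memLp_of_lintegral_sq_le (μ := μ) (by fun_prop) hv.le herr
  obtain ⟨hX2, -, hX1⟩ := moments_of_map_eq_gaussianReal hX hlaw
  by_cases htop : mutualInfo X U μ = ∞
  · simp [htop]
  have hv₀' : (0 : ℝ) < v₀ := by positivity
  have := Measure.isProbabilityMeasure_map (μ := μ) hX.aemeasurable
  have := Measure.isProbabilityMeasure_map (μ := μ) hU.aemeasurable
  have hPprob : IsProbabilityMeasure (μ.map (fun ω => (U ω, X ω))) :=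
    Measure.isProbabilityMeasure_map (by fun_prop)
  rw [mutualInfo] at htop ⊢
  set P := μ.map (fun ω => (U ω, X ω)) with hP
  set ν := (μ.map U).prod (μ.map X) with hν
  obtain ⟨hac, hint⟩ := klDiv_ne_top_iff.1 htop
  set w : ℝ≥0 := ⟨v, hv.le⟩ with hw
  have hw0 : w ≠ 0 := fun h => hv.ne' (congrArg NNReal.toReal h)
  -- Donsker–Varadhan test function: the log ratio of the guessed posterior `N(φ(u), v)` to the
  -- prior `N(0, v₀)`. Its mean under the joint law is at least the claimed bound, and its
  -- exponential has integral 1 under the product of marginals.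
  set F : 𝒵 × ℝ → ℝ := fun p => Real.log (gaussianPDFReal (φ p.1) w p.2)
    - Real.log (gaussianPDFReal 0 v₀ p.2) with hF
  have hFeq : ∀ p, F p = 1 / 2 * Real.log (v₀ / v) + p.2 ^ 2 / (2 * v₀)
      - (p.2 - φ p.1) ^ 2 / (2 * v) := by
    intro p
    rw [hF]
    simp only
    rw [log_gaussianPDFReal _ _ hw0, log_gaussianPDFReal _ _ hv₀, Real.log_div hv₀'.ne' hv.ne',
      Real.log_mul (by positivity) hv₀'.ne', show (w : ℝ) = v from rfl,
      Real.log_mul (by positivity) hv.ne']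
    ring
  have hFm : Measurable F := by
    have : F = fun p => 1 / 2 * Real.log (v₀ / v) + p.2 ^ 2 / (2 * v₀)
      - (p.2 - φ p.1) ^ 2 / (2 * v) := funext hFeq
    rw [this]
    fun_prop
  have i1 : Integrable (fun ω => X ω ^ 2) μ := hX2.integrable_sq
  have i2 : Integrable (fun ω => (X ω - φ (U ω)) ^ 2) μ := hmem.integrable_sq
  have hFP : Integrable F P := by
    rw [hP, integrable_map_measure hFm.aestronglyMeasurable (by fun_prop)]
    simp only [Function.comp_def, hFeq]
    fun_prop
  have hFint : 1 / 2 * Real.log (v₀ / v) ≤ ∫ p, F p ∂P := by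
    rw [hP, integral_map (by fun_prop) hFm.aestronglyMeasurable]
    simp only [hFeq]
    rw [integral_sub (by fun_prop) (by fun_prop), integral_add (by fun_prop) (by fun_prop),
      integral_div, integral_div, hX1]
    have : (∫ ω, (X ω - φ (U ω)) ^ 2 ∂μ) / (2 * v) ≤ 1 / 2 := by
      rw [div_le_div_iff₀ (by positivity) (by norm_num)]
      linarith
    have h2 : (v₀ : ℝ) / (2 * v₀) = 1 / 2 := by field_simp
    simp [h2] at this ⊢
    linarith
  have hlint : ∫⁻ p, ENNReal.ofReal (Real.exp (F p)) ∂ν = 1 := by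
    have hu : ∀ u, ∫⁻ y, ENNReal.ofReal (Real.exp (F (u, y))) ∂(gaussianReal 0 v₀) = 1 := by
      intro u
      rw [gaussianReal_of_var_ne_zero _ hv₀, lintegral_withDensity_eq_lintegral_mul _
        (measurable_gaussianPDF _ _) (by fun_prop), ← lintegral_gaussianPDF_eq_one (φ u) hw0]
      refine lintegral_congr fun y => ?_
      have h0 := gaussianPDFReal_pos 0 v₀ y hv₀
      rw [Pi.mul_apply, gaussianPDF, gaussianPDF, ← ENNReal.ofReal_mul h0.le, hF]
      simp only
      rw [Real.exp_sub, Real.exp_log (gaussianPDFReal_pos _ _ _ hw0), Real.exp_log h0]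
      congr 1
      field_simp
    rw [hν, lintegral_prod _ (by fun_prop), hlaw]
    simp [hu]
  have hFν : Integrable (fun p => Real.exp (F p)) ν := by
    refine ⟨by fun_prop, ?_⟩
    rw [hasFiniteIntegral_iff_ofReal (ae_of_all _ fun p => (Real.exp_pos _).le), hlint]
    simp
  have hone : ∫ p, Real.exp (F p) ∂ν = 1 := by
    rw [integral_eq_lintegral_of_nonneg_ae (ae_of_all _ fun p => (Real.exp_pos _).le) (by fun_prop),
      hlint]
    simp
  -- Nonnegativity of the divergence from the joint law to `ν.tilted F` is exactly the variational
  -- inequality; the normalizing term is log 1 = 0.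
  have htilt := integral_llr_tilted_right hac hFP hFν hint
  have hprob : IsProbabilityMeasure (ν.tilted F) := isProbabilityMeasure_tilted hFν
  have hnn := integral_llr_add_sub_measure_univ_nonneg (μ := P) (ν := ν.tilted F)
    (hac.trans (absolutelyContinuous_tilted hFν)) (integrable_llr_tilted_right hac hFP hint hFν)
  rw [klDiv_of_ac_of_integrable hac hint]
  refine ENNReal.ofReal_le_ofReal ?_
  simp [hone] at htilt hnn ⊢
  linarith

end Gaussian

/-! ### Improving the side information by a coupling -/

section Coupling

variable {Ω 𝒰 α β γ : Type} [MeasurableSpace Ω] [MeasurableSpace 𝒰] [MeasurableSpace α]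
  [MeasurableSpace β] [MeasurableSpace γ]

/-- The hypotheses make the law of the triple a product of three marginals, which can be grouped as
one pleases. -/
theorem IndepFun.assoc {μ : Measure Ω} [IsProbabilityMeasure μ] {p : Ω → α} {a : Ω → β}
    {b : Ω → γ} (hp : Measurable p) (ha : Measurable a) (hb : Measurable b)
    (h : IndepFun p (fun ω => (a ω, b ω)) μ) (hab : IndepFun a b μ) :
    IndepFun b (fun ω => (p ω, a ω)) μ := by
  have := Measure.isProbabilityMeasure_map (μ := μ) hp.aemeasurable
  have := Measure.isProbabilityMeasure_map (μ := μ) ha.aemeasurable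
  have := Measure.isProbabilityMeasure_map (μ := μ) hb.aemeasurable
  have hpa : IndepFun p a μ := h.comp measurable_id measurable_fst
  rw [indepFun_iff_map_prod_eq_prod_map_map (by fun_prop) (by fun_prop)] at h hab hpa
  refine IndepFun.symm ?_
  rw [indepFun_iff_map_prod_eq_prod_map_map (by fun_prop) (by fun_prop), hpa]
  rw [hab] at h
  have h' := congrArg (fun m => m.map (MeasurableEquiv.prodAssoc (α := α) (β := β) (γ := γ)).symm) h
  rw [Measure.map_map (MeasurableEquiv.measurable _) (by fun_prop),
    (measurePreserving_prodAssoc _ _ _).symm.map_eq] at h'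
  exact h'

/-- The law of a pair of independent standard Gaussians is invariant under reflections. -/
theorem map_reflection_gaussianReal {c d : ℝ} (hcd : c ^ 2 + d ^ 2 = 1) :
    ((gaussianReal 0 1).prod (gaussianReal 0 1)).map
      (fun p => (c * p.1 + d * p.2, d * p.1 - c * p.2)) =
      (gaussianReal 0 1).prod (gaussianReal 0 1) := by
  set P : Measure (ℝ × ℝ) := (gaussianReal 0 1).prod (gaussianReal 0 1) with hP
  have h1 : P.map Prod.fst = gaussianReal 0 1 := by rw [hP, Measure.map_fst_prod]; simp
  have h2 : P.map Prod.snd = gaussianReal 0 1 := by rw [hP, Measure.map_snd_prod]; simp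
  have l1 : HasLaw (Prod.fst : ℝ × ℝ → ℝ) (gaussianReal 0 1) P := ⟨by fun_prop, h1⟩
  have l2 : HasLaw (Prod.snd : ℝ × ℝ → ℝ) (gaussianReal 0 1) P := ⟨by fun_prop, h2⟩
  have hind : IndepFun (Prod.fst : ℝ × ℝ → ℝ) Prod.snd P :=
    indepFun_prod measurable_id measurable_id
  have hg : HasGaussianLaw (fun p : ℝ × ℝ => (p.1, p.2)) P :=
    hind.hasGaussianLaw l1.hasGaussianLaw l2.hasGaussianLaw
  obtain ⟨m1, z1, v1⟩ := moments_of_map_eq_gaussianReal measurable_fst h1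
  obtain ⟨m2, z2, v2⟩ := moments_of_map_eq_gaussianReal measurable_snd h2
  have hc : cov[Prod.fst, Prod.snd; P] = 0 := hind.covariance_eq_zero m1 m2
  have hc' : cov[Prod.snd, Prod.fst; P] = 0 := by rw [covariance_comm, hc]
  have hv1 : cov[Prod.fst, Prod.fst; P] = 1 := by
    rw [covariance_self (by fun_prop), l1.variance_eq, variance_id_gaussianReal]; rfl
  have hv2 : cov[Prod.snd, Prod.snd; P] = 1 := by
    rw [covariance_self (by fun_prop), l2.variance_eq, variance_id_gaussianReal]; rfl
  have hgg : HasGaussianLaw (fun p : ℝ × ℝ => (c * p.1 + d * p.2, d * p.1 - c * p.2)) P :=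
    hg.map_fun (((c • ContinuousLinearMap.fst ℝ ℝ ℝ + d • ContinuousLinearMap.snd ℝ ℝ ℝ)).prod
      (d • ContinuousLinearMap.fst ℝ ℝ ℝ - c • ContinuousLinearMap.snd ℝ ℝ ℝ))
  -- The rows `(c, d)` and `(d, -c)` are orthogonal, and uncorrelated jointly Gaussian variables are
  -- independent.
  have hI : IndepFun (fun p : ℝ × ℝ => c * p.1 + d * p.2) (fun p => d * p.1 - c * p.2) P := by
    refine hgg.indepFun_of_covariance_eq_zero ?_
    have e := covariance_add_left (μ := P) (m1.const_mul c) (m2.const_mul d)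
      ((m1.const_mul d).sub (m2.const_mul c))
    refine e.trans ?_
    rw [covariance_sub_right (m1.const_mul c) (m1.const_mul d) (m2.const_mul c),
      covariance_sub_right (m2.const_mul d) (m1.const_mul d) (m2.const_mul c)]
    simp only [covariance_const_mul_left, covariance_const_mul_right, hc, hc', hv1, hv2]
    ring
  rw [(indepFun_iff_map_prod_eq_prod_map_map (by fun_prop) (by fun_prop)).1 hI]
  have k : ∀ c d : ℝ, c ^ 2 + d ^ 2 = 1 →
      P.map (fun p : ℝ × ℝ => c * p.1 + d * p.2) = gaussianReal 0 1 := by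
    intro c d hcd
    have h := gaussianReal_add_gaussianReal_of_indepFun
      (hind.comp (measurable_const_mul c) (measurable_const_mul d))
      (gaussianReal_const_mul l1 c).map_eq (gaussianReal_const_mul l2 d).map_eq
    refine h.trans ?_
    congr 1
    · simp
    · ext
      simp [hcd]
  have k2 := k d (-c) (by linarith [neg_sq c])
  simp only [neg_mul, ← sub_eq_add_neg] at k2
  rw [k c d hcd, k2]

variable {μ : Measure Ω} [IsProbabilityMeasure μ]

/-- The error of the linear update of an estimate with error `D` by an observation of gain `r`. -/
theorem lintegral_sq_linear_update_le {D N : Ω → ℝ} (hDm : Measurable D) (hNm : Measurable N)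
    (hlaw : μ.map N = gaussianReal 0 1) (hND : IndepFun N D μ) {v : ℝ} (hv : 0 < v) (r : ℝ)
    (herr : ∫⁻ ω, ENNReal.ofReal (D ω ^ 2) ∂μ ≤ ENNReal.ofReal v) :
    ∫⁻ ω, ENNReal.ofReal (((D ω - v * r * N ω) / (1 + v * r ^ 2)) ^ 2) ∂μ ≤
      ENNReal.ofReal ((v⁻¹ + r ^ 2)⁻¹) := by
  obtain ⟨hD2, hDv⟩ := memLp_of_lintegral_sq_le hDm hv.le herr
  obtain ⟨hN2, hN0, hN1⟩ := moments_of_map_eq_gaussianReal hNm hlaw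
  have hden : 0 < 1 + v * r ^ 2 := by positivity
  have hee : ∀ ω, ((D ω - v * r * N ω) / (1 + v * r ^ 2)) ^ 2 =
      (D ω ^ 2 - 2 * (v * r) * (N ω * D ω) + (v * r) ^ 2 * N ω ^ 2) / (1 + v * r ^ 2) ^ 2 := by
    intro ω
    rw [div_pow]
    ring
  have i1 : Integrable (fun ω => N ω ^ 2) μ := hN2.integrable_sq
  have i2 : Integrable (fun ω => D ω ^ 2) μ := hD2.integrable_sq
  have i3 : Integrable (fun ω => N ω * D ω) μ :=
    hND.integrable_mul (hN2.integrable one_le_two) (hD2.integrable one_le_two)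
  have hND0 : ∫ ω, N ω * D ω ∂μ = 0 := by
    rw [hND.integral_fun_mul_eq_mul_integral hN2.aestronglyMeasurable hD2.aestronglyMeasurable,
      hN0, zero_mul]
  rw [← ofReal_integral_eq_lintegral_ofReal (by simp only [hee]; fun_prop)
    (ae_of_all _ fun ω => sq_nonneg _)]
  refine ENNReal.ofReal_le_ofReal ?_
  simp only [hee]
  rw [integral_div, integral_add (by fun_prop) (by fun_prop),
    integral_sub (by fun_prop) (by fun_prop), integral_const_mul, integral_const_mul, hND0, hN1]
  -- The right side is the mean squared error when `D` has second moment exactly `v`; its numerator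
  -- is v (1 + v r²).
  have : (v⁻¹ + r ^ 2)⁻¹ = (v + v ^ 2 * r ^ 2) / (1 + v * r ^ 2) ^ 2 := by
    have h : v⁻¹ + r ^ 2 = (1 + v * r ^ 2) / v := by field_simp
    rw [h, inv_div, div_eq_div_iff hden.ne' (by positivity)]
    ring
  rw [this]
  refine div_le_div_of_nonneg_right ?_ (sq_nonneg _)
  simp only [NNReal.coe_one]
  linarith

/-- `Y = √s X + Z` with `Z ∼ N(0, 1)` independent of `(X, U)`, as a statement about laws. -/
def IsSideInfo (s : ℝ) (X : Ω → ℝ) (U : Ω → 𝒰) (Y : Ω → ℝ) (μ : Measure Ω) : Prop :=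
  μ.map (fun ω => ((X ω, U ω), Y ω)) =
    μ.map (fun ω => (X ω, U ω)) ⊗ₘ gaussianKernel (fun p => √s * p.1) (by fun_prop) 1

theorem isSideInfo_add_noise (s : ℝ) {X : Ω → ℝ} {U : Ω → 𝒰} {N : Ω → ℝ} (hX : Measurable X)
    (hU : Measurable U) (hN : Measurable N) (hlaw : μ.map N = gaussianReal 0 1)
    (hind : IndepFun N (fun ω => (X ω, U ω)) μ) :
    IsSideInfo s X U (fun ω => √s * X ω + N ω) μ :=
  map_add_noise (T := fun ω => (X ω, U ω)) (by fun_prop) hN hlaw hind (f := fun p => √s * p.1)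
    (by fun_prop)

section Step

variable {X Y Y' : Ω → ℝ} {U : Ω → 𝒰} {s s' : ℝ} {φ : ℝ × 𝒰 → ℝ} {v : ℝ}

/-- The coupling space: the law of `(X, U)` together with two independent standard Gaussians. -/
def couplingMeasure (X : Ω → ℝ) (U : Ω → 𝒰) (μ : Measure Ω) : Measure ((ℝ × 𝒰) × ℝ × ℝ) :=
  (μ.map (fun ω => (X ω, U ω))).prod ((gaussianReal 0 1).prod (gaussianReal 0 1))

theorem isProbabilityMeasure_couplingMeasure (hX : Measurable X) (hU : Measurable U) :
    IsProbabilityMeasure (couplingMeasure X U μ) := by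
  have : IsProbabilityMeasure (μ.map (fun ω => (X ω, U ω))) :=
    Measure.isProbabilityMeasure_map (by fun_prop)
  unfold couplingMeasure
  infer_instance

/-- Only the pair of noises moves, and its law is invariant. The reflection relates the noise of the
stronger observation to the two noises of the weaker observation and of the increment. -/
theorem couplingMeasure_reflection (hX : Measurable X) (hU : Measurable U) {c d : ℝ}
    (hcd : c ^ 2 + d ^ 2 = 1) :
    (couplingMeasure X U μ).map
      (fun ω => (ω.1, c * ω.2.1 + d * ω.2.2, d * ω.2.1 - c * ω.2.2)) = couplingMeasure X U μ := by
  have : IsProbabilityMeasure (μ.map (fun ω => (X ω, U ω))) :=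
    Measure.isProbabilityMeasure_map (by fun_prop)
  have h := Measure.map_prod_map (μ.map (fun ω => (X ω, U ω)))
    ((gaussianReal 0 1).prod (gaussianReal 0 1)) measurable_id
    (g := fun p => (c * p.1 + d * p.2, d * p.1 - c * p.2)) (by fun_prop)
  rw [map_reflection_gaussianReal hcd, Measure.map_id] at h
  exact h.symm

/-- Noises on the coupling space are standard Gaussian and independent of `(X, U)`, and of one
another. -/
theorem couplingMeasure_noise (hX : Measurable X) (hU : Measurable U) :
    (couplingMeasure X U μ).map (fun ω => ω.2.1) = gaussianReal 0 1 ∧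
    (couplingMeasure X U μ).map (fun ω => ω.2.2) = gaussianReal 0 1 ∧
    IndepFun (fun ω => ω.2.1) (fun ω => ω.1) (couplingMeasure X U μ) ∧
    IndepFun (fun ω => ω.2.2) (fun ω => (ω.1, ω.2.1)) (couplingMeasure X U μ) := by
  have : IsProbabilityMeasure (μ.map (fun ω => (X ω, U ω))) :=
    Measure.isProbabilityMeasure_map (by fun_prop)
  have hm := isProbabilityMeasure_couplingMeasure (μ := μ) hX hU
  have h2 : (couplingMeasure X U μ).map Prod.snd = (gaussianReal 0 1).prod (gaussianReal 0 1) := by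
    rw [couplingMeasure, Measure.map_snd_prod]; simp
  have hI : IndepFun (fun ω => ω.1) (fun ω => ω.2) (couplingMeasure X U μ) :=
    indepFun_prod measurable_id measurable_id
  have k1 : (couplingMeasure X U μ).map (fun ω => ω.2.1) = gaussianReal 0 1 := by
    rw [← Function.comp_def Prod.fst Prod.snd, ← Measure.map_map (by fun_prop) (by fun_prop), h2,
      Measure.map_fst_prod]
    simp
  have k2 : (couplingMeasure X U μ).map (fun ω => ω.2.2) = gaussianReal 0 1 := by
    rw [← Function.comp_def Prod.snd Prod.snd, ← Measure.map_map (by fun_prop) (by fun_prop), h2,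
      Measure.map_snd_prod]
    simp
  have hJ : IndepFun (fun ω => ω.2.1) (fun ω => ω.2.2) (couplingMeasure X U μ) := by
    rw [indepFun_iff_map_prod_eq_prod_map_map (by fun_prop) (by fun_prop), k1, k2]
    exact h2
  exact ⟨k1, k2, hI.symm.comp measurable_fst measurable_id,
    IndepFun.assoc (by fun_prop) (by fun_prop) (by fun_prop) hI hJ⟩

theorem IsSideInfo.law_eq_coupling (hX : Measurable X) (hU : Measurable U)
    (hY : IsSideInfo s X U Y μ) :
    μ.map (fun ω => ((X ω, U ω), Y ω)) =
      (couplingMeasure X U μ).map (fun ω => (ω.1, √s * ω.1.1 + ω.2.1)) := by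
  have hm := isProbabilityMeasure_couplingMeasure (μ := μ) hX hU
  have : IsProbabilityMeasure (μ.map (fun ω => (X ω, U ω))) :=
    Measure.isProbabilityMeasure_map (by fun_prop)
  obtain ⟨h1, -, h3, -⟩ := couplingMeasure_noise (μ := μ) hX hU
  have h := isSideInfo_add_noise s (X := fun ω : (ℝ × 𝒰) × ℝ × ℝ => ω.1.1)
    (U := fun ω => ω.1.2) (by fun_prop) (by fun_prop) (by fun_prop) h1 h3
  have e : (couplingMeasure X U μ).map (fun ω => (ω.1.1, ω.1.2)) =
      μ.map (fun ω => (X ω, U ω)) := by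
    change (couplingMeasure X U μ).map Prod.fst = _
    rw [couplingMeasure, Measure.map_fst_prod]; simp
  unfold IsSideInfo at h hY
  rw [hY, ← e, ← h]

theorem IsSideInfo.lintegral_eq_coupling (hX : Measurable X) (hU : Measurable U)
    (hYm : Measurable Y) (hY : IsSideInfo s X U Y μ) {F : (ℝ × 𝒰) × ℝ → ℝ≥0∞}
    (hF : Measurable F) :
    ∫⁻ ω, F ((X ω, U ω), Y ω) ∂μ =
      ∫⁻ ω, F (ω.1, √s * ω.1.1 + ω.2.1) ∂(couplingMeasure X U μ) := by
  rw [← lintegral_map (f := F) (g := fun ω => ((X ω, U ω), Y ω)) hF (by fun_prop),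
    hY.law_eq_coupling hX hU, lintegral_map hF (by fun_prop)]

/-- In law, `Y'` is a function of `Y` and of an independent observation of `X` with gain √(s' - s).
Data processing and the chain rule leave the information in that extra observation given `(Y, U)`,
which the estimator `φ` controls. -/
theorem mutualInfo_le_of_isSideInfo (hX : Measurable X) (hU : Measurable U) (hYm : Measurable Y)
    (hYm' : Measurable Y') (hY : IsSideInfo s X U Y μ) (hY' : IsSideInfo s' X U Y' μ)
    (hs : 0 ≤ s) (hss : s < s') (hφ : Measurable φ) (hv : 0 ≤ v)
    (herr : ∫⁻ ω, ENNReal.ofReal ((X ω - φ (Y ω, U ω)) ^ 2) ∂μ ≤ ENNReal.ofReal v) :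
    mutualInfo X (fun ω => (Y' ω, U ω)) μ ≤ mutualInfo X (fun ω => (Y ω, U ω)) μ +
      ENNReal.ofReal (1 / 2 * Real.log (1 + (s' - s) * v)) := by
  have hm := isProbabilityMeasure_couplingMeasure (μ := μ) hX hU
  obtain ⟨h1, h2, -, h4⟩ := couplingMeasure_noise (μ := μ) hX hU
  have hs' : 0 < √s' := Real.sqrt_pos.2 (hs.trans_lt hss)
  have q1 : √s ^ 2 = s := Real.sq_sqrt hs
  have q2 : √s' ^ 2 = s' := Real.sq_sqrt (hs.trans hss.le)
  have q3 : √(s' - s) ^ 2 = s' - s := Real.sq_sqrt (by linarith)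
  have hcd : (√s / √s') ^ 2 + (√(s' - s) / √s') ^ 2 = 1 := by
    rw [div_pow, div_pow, q1, q2, q3]
    have : s' ≠ 0 := (hs.trans_lt hss).ne'
    field_simp
    ring
  set μ' := couplingMeasure X U μ with hμ'
  -- Combining the two observations with weights proportional to their gains gives gain √s' and
  -- noise of unit variance.
  have key : ∀ ω : (ℝ × 𝒰) × ℝ × ℝ,
      √s' * ω.1.1 + (√s / √s' * ω.2.1 + √(s' - s) / √s' * ω.2.2) =
        (√s * (√s * ω.1.1 + ω.2.1) + √(s' - s) * (√(s' - s) * ω.1.1 + ω.2.2)) / √s' := by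
    intro ω
    rw [eq_div_iff hs'.ne']
    field_simp
    linear_combination ω.1.1 * q2 - ω.1.1 * q1 - ω.1.1 * q3
  have e1 : mutualInfo X (fun ω => (Y ω, U ω)) μ =
      mutualInfo (fun ω => ω.1.1) (fun ω => (√s * ω.1.1 + ω.2.1, ω.1.2)) μ' := by
    refine mutualInfo_congr_law hX (by fun_prop) (by fun_prop) (by fun_prop) ?_
    have h := congrArg (fun m => m.map (fun p : (ℝ × 𝒰) × ℝ => ((p.2, p.1.2), p.1.1)))
      (hY.law_eq_coupling hX hU)
    rw [Measure.map_map (by fun_prop) (by fun_prop),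
      Measure.map_map (by fun_prop) (by fun_prop)] at h
    exact h
  have e2 : mutualInfo X (fun ω => (Y' ω, U ω)) μ =
      mutualInfo (fun ω => ω.1.1)
        (fun ω => (√s' * ω.1.1 + (√s / √s' * ω.2.1 + √(s' - s) / √s' * ω.2.2), ω.1.2)) μ' := by
    refine mutualInfo_congr_law hX (by fun_prop) (by fun_prop) (by fun_prop) ?_
    have h := congrArg (fun m => m.map (fun p : (ℝ × 𝒰) × ℝ => ((p.2, p.1.2), p.1.1)))
      (hY'.law_eq_coupling hX hU)
    rw [← couplingMeasure_reflection hX hU hcd, Measure.map_map (by fun_prop) (by fun_prop),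
      Measure.map_map (by fun_prop) (by fun_prop),
      Measure.map_map (by fun_prop) (by fun_prop)] at h
    exact h
  have e3 : mutualInfo X (fun ω => (Y' ω, U ω)) μ ≤ mutualInfo (fun ω => ω.1.1)
      (fun ω => ((√s * ω.1.1 + ω.2.1, ω.1.2), √(s' - s) * ω.1.1 + ω.2.2)) μ' := by
    rw [e2]
    simp only [key]
    exact mutualInfo_comp_le (μ := μ') (X := fun ω => ω.1.1)
      (U := fun ω => ((√s * ω.1.1 + ω.2.1, ω.1.2), √(s' - s) * ω.1.1 + ω.2.2))
      (f := fun p => ((√s * p.1.1 + √(s' - s) * p.2) / √s', p.1.2))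
      (by fun_prop) (by fun_prop) (by fun_prop)
  refine e3.trans ?_
  rw [mutualInfo_prodMk (μ := μ') (X := fun ω => ω.1.1)
    (Z := fun ω => (√s * ω.1.1 + ω.2.1, ω.1.2)) (W := fun ω => √(s' - s) * ω.1.1 + ω.2.2)
    (by fun_prop) (by fun_prop) (by fun_prop), e1]
  refine add_le_add le_rfl ?_
  -- The increment has to appear as the square of a gain to match `condMutualInfo_add_noise_le`.
  conv_rhs => rw [← q3]
  refine condMutualInfo_add_noise_le (by fun_prop) (by fun_prop) (by fun_prop) h2 ?_ _ hφ hv ?_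
  · exact h4.comp measurable_id
      (ψ := fun p : (ℝ × 𝒰) × ℝ => ((√s * p.1.1 + p.2, p.1.2), p.1.1)) (by fun_prop)
  · rw [hY.lintegral_eq_coupling hX hU hYm (F := fun p => ENNReal.ofReal
      ((p.1.1 - φ (p.2, p.1.2)) ^ 2)) (by fun_prop)] at herr
    exact herr

/-- On the coupling space, a linear update of `φ` by the extra observation adds s' - s to the
precision. The pair of observations is not a function of `Y'`, but it is one of `Y'` and an
independent noise. Freezing that noise at a value no worse than average leaves a function of `(Y',
U)` alone. -/
theorem exists_estimator_of_isSideInfo (hX : Measurable X) (hU : Measurable U)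
    (hYm : Measurable Y) (hYm' : Measurable Y') (hY : IsSideInfo s X U Y μ)
    (hY' : IsSideInfo s' X U Y' μ) (hs : 0 ≤ s) (hss : s < s') (hφ : Measurable φ) (hv : 0 < v)
    (herr : ∫⁻ ω, ENNReal.ofReal ((X ω - φ (Y ω, U ω)) ^ 2) ∂μ ≤ ENNReal.ofReal v) :
    ∃ ψ : ℝ × 𝒰 → ℝ, Measurable ψ ∧
      ∫⁻ ω, ENNReal.ofReal ((X ω - ψ (Y' ω, U ω)) ^ 2) ∂μ ≤
        ENNReal.ofReal ((v⁻¹ + s' - s)⁻¹) := by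
  have hm := isProbabilityMeasure_couplingMeasure (μ := μ) hX hU
  have hPm : IsProbabilityMeasure (μ.map (fun ω => (X ω, U ω))) :=
    Measure.isProbabilityMeasure_map (by fun_prop)
  obtain ⟨h1, h2, -, h4⟩ := couplingMeasure_noise (μ := μ) hX hU
  have hs' : 0 < √s' := Real.sqrt_pos.2 (hs.trans_lt hss)
  have q1 : √s ^ 2 = s := Real.sq_sqrt hs
  have q2 : √s' ^ 2 = s' := Real.sq_sqrt (hs.trans hss.le)
  have q3 : √(s' - s) ^ 2 = s' - s := Real.sq_sqrt (by linarith)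
  set c := √s / √s' with hc
  set d := √(s' - s) / √s' with hd
  have hcd : c ^ 2 + d ^ 2 = 1 := by
    rw [hc, hd, div_pow, div_pow, q1, q2, q3]
    have : s' ≠ 0 := (hs.trans_lt hss).ne'
    field_simp
    ring
  have hcs : c * √s' = √s := by rw [hc]; field_simp
  have hds : d * √s' = √(s' - s) := by rw [hd]; field_simp
  set μ' := couplingMeasure X U μ with hμ'
  set r := √(s' - s) with hr
  have hΔ : 0 < s' - s := by linarith
  have hden : 0 < 1 + v * (s' - s) := by positivity
  rw [hY.lintegral_eq_coupling hX hU hYm (F := fun p => ENNReal.ofReal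
      ((p.1.1 - φ (p.2, p.1.2)) ^ 2)) (by fun_prop)] at herr
  set D : (ℝ × 𝒰) × ℝ × ℝ → ℝ := fun ω => ω.1.1 - φ (√s * ω.1.1 + ω.2.1, ω.1.2) with hD
  have hDm : Measurable D := by fun_prop
  -- Averages the old estimate with precision `v⁻¹` and the new one `t / r` with precision `r²`.
  set est : ℝ → ℝ → 𝒰 → ℝ := fun y t u => (φ (y, u) + v * r * t) / (1 + v * (s' - s)) with hest
  set e : (ℝ × 𝒰) × ℝ × ℝ → ℝ := fun ω =>
    ω.1.1 - est (√s * ω.1.1 + ω.2.1) (r * ω.1.1 + ω.2.2) ω.1.2 with he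
  have hee : ∀ ω, e ω = (D ω - v * r * ω.2.2) / (1 + v * r ^ 2) := by
    intro ω
    rw [q3, eq_div_iff hden.ne', he, hest, hD]
    field_simp
    linear_combination (-(ω.1.1 * v)) * q3
  have hem : Measurable e := by fun_prop
  have hND : IndepFun (fun ω : (ℝ × 𝒰) × ℝ × ℝ => ω.2.2) D μ' :=
    h4.comp measurable_id
      (ψ := fun p : (ℝ × 𝒰) × ℝ => p.1.1 - φ (√s * p.1.1 + p.2, p.1.2)) (by fun_prop)
  have hbound : ∫⁻ ω, ENNReal.ofReal (e ω ^ 2) ∂μ' ≤ ENNReal.ofReal ((v⁻¹ + s' - s)⁻¹) := by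
    have h := lintegral_sq_linear_update_le hDm (by fun_prop) h2 hND hv r herr
    simp only [← hee] at h
    rwa [q3, ← add_sub_assoc] at h
  -- Here `p.2` plays the role of `Y'` and `z` of the independent noise; the reflection recovers
  -- from them the weaker observation and the increment.
  set G : ((ℝ × 𝒰) × ℝ) → ℝ → ℝ := fun p z =>
    p.1.1 - est (c * p.2 + d * z) (d * p.2 - c * z) p.1.2 with hG
  have hGe : ∀ p : ℝ × 𝒰, ∀ z₁ z₂ : ℝ, G (p, √s' * p.1 + z₁) z₂ =
      e (p, c * z₁ + d * z₂, d * z₁ - c * z₂) := by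
    intro p z₁ z₂
    simp only [hG, he]
    congr 2
    · linear_combination p.1 * hcs
    · linear_combination p.1 * hds
  have hint : ∫⁻ ω, ENNReal.ofReal (G (ω.1, √s' * ω.1.1 + ω.2.1) ω.2.2 ^ 2) ∂μ' ≤
      ENNReal.ofReal ((v⁻¹ + s' - s)⁻¹) := by
    refine le_trans (le_of_eq ?_) hbound
    conv_rhs => rw [hμ', ← couplingMeasure_reflection hX hU hcd,
      lintegral_map (by fun_prop) (by fun_prop)]
    simp only [hGe, hμ']
  have hGm : Measurable fun q : ((ℝ × 𝒰) × ℝ) × ℝ => G q.1 q.2 := by fun_prop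
  -- By independence the error is an average over `z`, so some value does at least as well as the
  -- average.
  obtain ⟨z, hz⟩ : ∃ z, ∫⁻ ω, ENNReal.ofReal (G (ω.1, √s' * ω.1.1 + ω.2.1) z ^ 2) ∂μ' ≤
      ENNReal.ofReal ((v⁻¹ + s' - s)⁻¹) := by
    have hl := (indepFun_iff_map_prod_eq_prod_map_map (by fun_prop) (by fun_prop)).1 h4
    have := Measure.isProbabilityMeasure_map (μ := μ') (f := fun ω => ω.2.2) (by fun_prop)
    have e1 : ∫⁻ ω, ENNReal.ofReal (G (ω.1, √s' * ω.1.1 + ω.2.1) ω.2.2 ^ 2) ∂μ' =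
        ∫⁻ z, ∫⁻ ω, ENNReal.ofReal (G (ω.1, √s' * ω.1.1 + ω.2.1) z ^ 2) ∂μ'
          ∂(μ'.map (fun ω => ω.2.2)) := by
      have e2 := lintegral_map (μ := μ') (g := fun ω => (ω.2.2, ω.1, ω.2.1))
        (f := fun q : ℝ × (ℝ × 𝒰) × ℝ =>
          ENNReal.ofReal (G (q.2.1, √s' * q.2.1.1 + q.2.2) q.1 ^ 2)) (by fun_prop) (by fun_prop)
      rw [← e2, hl, lintegral_prod _ (by fun_prop)]
      refine lintegral_congr fun z => ?_
      rw [lintegral_map (by fun_prop) (by fun_prop)]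
    rw [e1] at hint
    obtain ⟨z, hz⟩ := exists_le_lintegral (μ := μ'.map (fun ω => ω.2.2))
      (f := fun z => ∫⁻ ω, ENNReal.ofReal (G (ω.1, √s' * ω.1.1 + ω.2.1) z ^ 2) ∂μ')
      (Measurable.lintegral_prod_right' (f := fun q : ℝ × (ℝ × 𝒰) × ℝ × ℝ =>
        ENNReal.ofReal (G (q.2.1, √s' * q.2.1.1 + q.2.2.1) q.1 ^ 2)) (by fun_prop)).aemeasurable
    exact ⟨z, hz.trans hint⟩
  refine ⟨fun q => est (c * q.1 + d * z) (d * q.1 - c * z) q.2, by fun_prop, ?_⟩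
  rw [← hY'.lintegral_eq_coupling hX hU hYm' (F := fun p => ENNReal.ofReal (G p z ^ 2))
    (by fun_prop)] at hz
  exact hz

end Step

end Coupling

/-! ### The recursion for `V` -/

section Parameters

variable {m : ℕ} (σ : ℝ≥0) (s D : Fin (m + 1) → ℝ)

theorem V_zero : V σ s D 0 = min ((((σ : ℝ) ^ 2)⁻¹ + s 0)⁻¹) (D 0) := rfl

theorem V_succ (i : Fin m) : V σ s D i.succ =
    min (((V σ s D i.castSucc)⁻¹ + s i.succ - s i.castSucc)⁻¹) (D i.succ) := by
  simp [V, Fin.induction_succ]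

theorem priorV_zero : priorV σ s D 0 = (((σ : ℝ) ^ 2)⁻¹ + s 0)⁻¹ := rfl

theorem priorV_succ (i : Fin m) : priorV σ s D i.succ =
    ((V σ s D i.castSucc)⁻¹ + s i.succ - s i.castSucc)⁻¹ := rfl

theorem V_eq_min (i : Fin (m + 1)) : V σ s D i = min (priorV σ s D i) (D i) := by
  cases i using Fin.cases with
  | zero => rw [V_zero, priorV_zero]
  | succ i => rw [V_succ, priorV_succ]

variable {σ s D}

theorem V_pos (hσ : 0 < σ) (hs0 : 0 ≤ s 0) (hs : StrictMono s) (hD : ∀ i, 0 < D i)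
    (i : Fin (m + 1)) : 0 < V σ s D i := by
  have hσ' : (0 : ℝ) < σ := hσ
  induction i using Fin.induction with
  | zero => exact lt_min (by positivity) (hD 0)
  | succ i ih =>
    rw [V_succ]
    have := hs (Fin.castSucc_lt_succ (i := i))
    refine lt_min (inv_pos.2 ?_) (hD _)
    have := inv_pos.2 ih
    linarith

theorem priorV_pos (hσ : 0 < σ) (hs0 : 0 ≤ s 0) (hs : StrictMono s) (hD : ∀ i, 0 < D i)
    (i : Fin (m + 1)) : 0 < priorV σ s D i :=
  (V_pos hσ hs0 hs hD i).trans_le (by rw [V_eq_min]; exact min_le_left _ _)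

/-- The sum telescopes: `priorV` at i+1 equals V_i / (1 + (s_{i+1} - s_i) V_i), so every log V_i
except the last cancels. -/
theorem sum_log_priorV_div_V (hσ : 0 < σ) (hs0 : 0 ≤ s 0) (hs : StrictMono s)
    (hD : ∀ i, 0 < D i) :
    ∑ i, 1 / 2 * Real.log (priorV σ s D i / V σ s D i) = gaussianRate σ s D := by
  have hV := V_pos hσ hs0 hs hD
  have hP := priorV_pos hσ hs0 hs hD
  have h1 : ∀ i, 1 / 2 * Real.log (priorV σ s D i / V σ s D i) =
      1 / 2 * Real.log (priorV σ s D i) - 1 / 2 * Real.log (V σ s D i) := by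
    intro i
    rw [Real.log_div (hP i).ne' (hV i).ne']
    ring
  have h2 : ∀ i : Fin m, Real.log (priorV σ s D i.succ) = Real.log (V σ s D i.castSucc) -
      Real.log (1 + (s i.succ - s i.castSucc) * V σ s D i.castSucc) := by
    intro i
    have hv := hV i.castSucc
    have := hs (Fin.castSucc_lt_succ (i := i))
    have hd : 0 < s i.succ - s i.castSucc := by linarith
    rw [priorV_succ, ← Real.log_div hv.ne' (by positivity)]
    congr 1
    rw [inv_eq_iff_eq_inv, inv_div]
    field_simp
    ring
  simp only [h1, Finset.sum_sub_distrib]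
  rw [Fin.sum_univ_succ, Fin.sum_univ_castSucc (fun i => 1 / 2 * Real.log (V σ s D i))]
  simp only [h2, priorV_zero, Real.log_inv, gaussianRate, mul_sub, Finset.sum_sub_distrib,
    Finset.mul_sum]
  ring

end Parameters

/-! ### The converse -/

section Converse

theorem log_one_add_mul_sq {σ : ℝ≥0} (hσ : 0 < σ) {s : ℝ} (hs : 0 ≤ s) :
    Real.log (1 + s * (σ : ℝ) ^ 2) =
      Real.log ((σ : ℝ) ^ 2) + Real.log (((σ : ℝ) ^ 2)⁻¹ + s) := by
  have hσ' : (0 : ℝ) < σ := hσ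
  rw [← Real.log_mul (by positivity) (by positivity)]
  congr 1
  field_simp

theorem map_pair_eq_gaussianPair {Ω : Type} [MeasurableSpace Ω] {μ : Measure Ω} {m : ℕ}
    {σ : ℝ≥0} {s : Fin (m + 1) → ℝ} {Q : Measure (ℝ × (Fin (m + 1) → ℝ))} [IsProbabilityMeasure Q]
    {X : Ω → ℝ} {Y : Fin (m + 1) → Ω → ℝ} (hQ : IsGaussianDegradedLaw σ s Q) (hX : Measurable X)
    (hY : ∀ i, Measurable (Y i)) (hlaw : μ.map (fun ω => (X ω, fun i => Y i ω)) = Q)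
    (i : Fin (m + 1)) : μ.map (fun ω => (X ω, Y i ω)) = gaussianPair σ (s i) := by
  rw [← hQ.marginal i, ← hlaw, Measure.map_map (by fun_prop) (by fun_prop)]
  rfl

variable {Ω 𝒰 : Type} [MeasurableSpace Ω] {μ : Measure Ω} [IsProbabilityMeasure μ]

/-- Decomposition `Y = √s X + Z` of a pair with law `gaussianPair σ s`. -/
theorem gaussianPair_decomposition {σ : ℝ≥0} {s : ℝ} {X Y : Ω → ℝ} (hX : Measurable X)
    (hY : Measurable Y) (h : μ.map (fun ω => (X ω, Y ω)) = gaussianPair σ s) :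
    μ.map X = gaussianReal 0 (σ ^ 2) ∧ μ.map (fun ω => Y ω - √s * X ω) = gaussianReal 0 1 ∧
      IndepFun (fun ω => Y ω - √s * X ω) X μ := by
  have h' := congrArg (fun M => M.map (fun p : ℝ × ℝ => (p.1, p.2 - √s * p.1))) h
  rw [gaussianPair, Measure.map_map (by fun_prop) (by fun_prop),
    Measure.map_map (by fun_prop) (by fun_prop)] at h'
  have e : ((fun p : ℝ × ℝ => (p.1, p.2 - √s * p.1)) ∘ fun p : ℝ × ℝ => (p.1, √s * p.1 + p.2)) =
      id := by
    funext p
    simp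
  rw [e, Measure.map_id] at h'
  have h1 : μ.map X = gaussianReal 0 (σ ^ 2) := by
    have h1 := congrArg (fun M => M.map Prod.fst) h'
    rw [Measure.map_map (by fun_prop) (by fun_prop), Measure.map_fst_prod, measure_univ, one_smul] at h1
    exact h1
  have h2 : μ.map (fun ω => Y ω - √s * X ω) = gaussianReal 0 1 := by
    have h1 := congrArg (fun M => M.map Prod.snd) h'
    rw [Measure.map_map (by fun_prop) (by fun_prop), Measure.map_snd_prod, measure_univ, one_smul] at h1
    exact h1
  refine ⟨h1, h2, IndepFun.symm ?_⟩
  rw [indepFun_iff_map_prod_eq_prod_map_map (by fun_prop) (by fun_prop), h1, h2]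
  exact h'

/-- The marginal fixes the kernel from `X` to `Y` as the Gaussian channel, and conditional
independence says that `U` does not alter this kernel. -/
theorem isSideInfo_of_condIndepFun [StandardBorelSpace Ω] [MeasurableSpace 𝒰]
    [StandardBorelSpace 𝒰] [Nonempty 𝒰] {σ : ℝ≥0} {s : ℝ} {X Y : Ω → ℝ} {U : Ω → 𝒰}
    (hX : Measurable X) (hY : Measurable Y) (hU : Measurable U)
    (h : μ.map (fun ω => (X ω, Y ω)) = gaussianPair σ s)
    (hci : CondIndepFun (MeasurableSpace.comap X inferInstance) hX.comap_le U Y μ) :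
    IsSideInfo s X U Y μ := by
  obtain ⟨-, h2, h3⟩ := gaussianPair_decomposition hX hY h
  have hk := map_add_noise hX (by fun_prop) h2 h3 (f := fun x => √s * x) (by fun_prop)
  simp only [add_sub_cancel] at hk
  have hae := condDistrib_ae_eq_of_measure_eq_compProd X hY.aemeasurable hk
  have hfst : μ.map X = (μ.map (fun ω => (X ω, U ω))).map Prod.fst := by
    rw [Measure.map_map (by fun_prop) (by fun_prop)]
    rfl
  rw [hfst] at hae
  rw [IsSideInfo, (condIndepFun_iff_map_eq_compProd hY hU hX).1 hci]
  refine Measure.compProd_congr ?_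
  filter_upwards [ae_of_ae_map (by fun_prop) hae] with p hp
  exact hp

/-- The upper estimate for Gaussian observations, used with trivial prior knowledge: the estimate 0
has error σ². -/
theorem mutualInfo_gaussianPair_le {σ : ℝ≥0} {s : ℝ} (hs : 0 ≤ s) {X Y : Ω → ℝ}
    (hX : Measurable X) (hY : Measurable Y)
    (h : μ.map (fun ω => (X ω, Y ω)) = gaussianPair σ s) :
    mutualInfo X Y μ ≤ ENNReal.ofReal (1 / 2 * Real.log (1 + s * (σ : ℝ) ^ 2)) := by
  obtain ⟨h1, h2, h3⟩ := gaussianPair_decomposition hX hY h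
  obtain ⟨-, -, h4⟩ := moments_of_map_eq_gaussianReal hX h1
  obtain ⟨h5, -, -⟩ := moments_of_map_eq_gaussianReal hX h1
  have e1 := mutualInfo_comp_le (μ := μ) (X := X) (U := fun ω => ((), Y ω)) hX (by fun_prop)
    (f := fun p : Unit × ℝ => p.2) measurable_snd
  refine e1.trans ?_
  have e2 := mutualInfo_prodMk (μ := μ) (X := X) (Z := fun _ => ()) (W := Y) hX hY (by fun_prop)
  have e3 : mutualInfo X (fun _ => ()) μ = 0 := by
    have hi : IndepFun (fun _ : Ω => ()) X μ := indepFun_const_left () X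
    rw [mutualInfo, (indepFun_iff_map_prod_eq_prod_map_map (by fun_prop) (by fun_prop)).1 hi]
    exact klDiv_self _
  rw [e2, e3, zero_add]
  have e4 := condMutualInfo_add_noise_le (μ := μ) (X := X) (N := fun ω => Y ω - √s * X ω)
    (Z := fun _ => ()) hX (by fun_prop) (by fun_prop) h2
    (h3.comp measurable_id (ψ := fun x => ((), x)) (by fun_prop)) √s (φ := fun _ => 0)
    measurable_const (v := (σ : ℝ) ^ 2) (by positivity) (by
      simp only [sub_zero]
      rw [← ofReal_integral_eq_lintegral_ofReal h5.integrable_sq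
        (ae_of_all _ fun ω => sq_nonneg _), h4]
      simp)
  simp only [add_sub_cancel, Real.sq_sqrt hs] at e4
  exact e4

theorem exists_estimator_gaussianPair {σ : ℝ≥0} (hσ : 0 < σ) {s : ℝ} (hs : 0 ≤ s) {X Y : Ω → ℝ}
    (hX : Measurable X) (hY : Measurable Y)
    (h : μ.map (fun ω => (X ω, Y ω)) = gaussianPair σ s) :
    ∃ ψ : ℝ → ℝ, Measurable ψ ∧ ∫⁻ ω, ENNReal.ofReal ((X ω - ψ (Y ω)) ^ 2) ∂μ ≤
      ENNReal.ofReal ((((σ : ℝ) ^ 2)⁻¹ + s)⁻¹) := by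
  obtain ⟨h1, h2, h3⟩ := gaussianPair_decomposition hX hY h
  obtain ⟨h5, -, h4⟩ := moments_of_map_eq_gaussianReal hX h1
  have hσ' : (0 : ℝ) < σ := hσ
  have hq := Real.sq_sqrt hs
  refine ⟨fun y => (σ : ℝ) ^ 2 * √s * y / (1 + (σ : ℝ) ^ 2 * s), by fun_prop, ?_⟩
  have e := lintegral_sq_linear_update_le (μ := μ) (D := X) (N := fun ω => Y ω - √s * X ω) hX
    (by fun_prop) h2 h3 (v := (σ : ℝ) ^ 2) (by positivity) √s (by
      rw [← ofReal_integral_eq_lintegral_ofReal h5.integrable_sq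
        (ae_of_all _ fun ω => sq_nonneg _), h4]
      simp)
  rw [hq] at e
  refine le_trans (le_of_eq ?_) e
  refine lintegral_congr fun ω => ?_
  congr 2
  have : 1 + (σ : ℝ) ^ 2 * s ≠ 0 := by positivity
  field_simp
  linear_combination (-(σ : ℝ) ^ 2 * X ω) * hq

/-- Bookkeeping for the converse: `c` is the information after each layer, `a` the rates, `b` the
gains from better side information and `k` the information in the first observation. -/
theorem le_add_sum_of_step {m : ℕ} (a c : Fin (m + 1) → ℝ≥0∞) (b : Fin m → ℝ≥0∞) (k : ℝ≥0∞)
    (h0 : c 0 ≤ k + a 0) (hstep : ∀ i : Fin m, c i.succ ≤ c i.castSucc + b i + a i.succ) :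
    c (Fin.last m) ≤ k + ∑ i, b i + ∑ i, a i := by
  induction m with
  | zero => simpa using h0
  | succ m ih =>
    have h := ih (fun i => a i.castSucc) (fun i => c i.castSucc) (fun i => b i.castSucc) h0
      (fun i => hstep i.castSucc)
    have h' := hstep (Fin.last m)
    rw [Fin.sum_univ_castSucc b, Fin.sum_univ_castSucc a]
    calc c (Fin.last (m + 1)) ≤ _ := h'
      _ ≤ (k + ∑ i : Fin m, b i.castSucc + ∑ i : Fin (m + 1), a i.castSucc) + b (Fin.last m)
          + a (Fin.last (m + 1)) :=         add_le_add (add_le_add h le_rfl) le_rfl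
      _ = _ := by ring

section Admissible

variable {m : ℕ} {𝒲 : Fin (m + 1) → Type} [∀ i, MeasurableSpace (𝒲 i)]
  [∀ i, StandardBorelSpace (𝒲 i)] [∀ i, Nonempty (𝒲 i)]
  {σ : ℝ≥0} {s D : Fin (m + 1) → ℝ} {Q : Measure (ℝ × (Fin (m + 1) → ℝ))} [IsProbabilityMeasure Q]
  {X : Ω → ℝ} {Y : Fin (m + 1) → Ω → ℝ} {W : ∀ i, Ω → 𝒲 i}

/-- The layers up to `i`. -/
def layersLE (W : ∀ i, Ω → 𝒲 i) (i : Fin (m + 1)) (ω : Ω) : ∀ j : {j // j ≤ i}, 𝒲 j :=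
  fun j => W j ω

/-- The chain rule, after observing that `obsLE` is a measurable function of `obsLT` and `W i`; only
this direction of the reindexing is needed. -/
theorem mutualInfo_obsLE_le (hX : Measurable X) (hY : ∀ i, Measurable (Y i))
    (hW : ∀ i, Measurable (W i)) (i : Fin (m + 1)) :
    mutualInfo X (obsLE Y W i) μ ≤
      mutualInfo X (obsLT Y W i) μ + condMutualInfo X (W i) (obsLT Y W i) μ := by
  have hobs : Measurable (obsLT Y W i) := by unfold obsLT; fun_prop
  rw [← mutualInfo_prodMk hX (hW i) hobs]
  set g : (ℝ × (∀ j : {j : Fin (m + 1) // j < i}, 𝒲 j)) × 𝒲 i →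
      ℝ × (∀ j : {j : Fin (m + 1) // j ≤ i}, 𝒲 j) := fun p => (p.1.1, fun j =>
    if hj : j.1 < i then p.1.2 ⟨j, hj⟩ else
      Eq.rec (motive := fun k _ => 𝒲 k) p.2 (le_antisymm (not_lt.1 hj) j.2)) with hg
  have hgm : Measurable g := by
    refine Measurable.prodMk (by fun_prop) (measurable_pi_iff.2 ?_)
    rintro ⟨j, hj⟩
    rcases hj.lt_or_eq with hj' | rfl
    · simp only [hj', dite_true]
      fun_prop
    · simp only [lt_irrefl, dite_false]
      fun_prop
  have e : obsLE Y W i = fun ω => g (obsLT Y W i ω, W i ω) := by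
    funext ω
    refine Prod.ext rfl (funext ?_)
    rintro ⟨j, hj⟩
    rcases hj.lt_or_eq with hj' | rfl
    · simp [hg, obsLE, obsLT, hj']
    · simp [hg, obsLE]
  rw [e]
  exact mutualInfo_comp_le hX (by fun_prop) hgm

variable [StandardBorelSpace Ω]

theorem IsAdmissible.isSideInfo (h : IsAdmissible Q sqDist D μ X Y W)
    (hQ : IsGaussianDegradedLaw σ s Q) (i k : Fin (m + 1)) :
    IsSideInfo (s k) X (layersLE W i) (Y k) μ := by
  have hW := h.measurable_W
  refine isSideInfo_of_condIndepFun h.measurable_X (h.measurable_Y k)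
    (by unfold layersLE; fun_prop)
    (map_pair_eq_gaussianPair hQ h.measurable_X h.measurable_Y h.law k) ?_
  have hk : Measurable (fun y : Fin (m + 1) → ℝ => y k) := measurable_pi_apply k
  have hφ : Measurable (fun (w : ∀ j, 𝒲 j) (j : {j // j ≤ i}) => w j) := by fun_prop
  exact h.markov_X.comp hφ hk

/-- Each branch of the minimum defining `V` has its own estimator: the decoder supplied by
admissibility, or the previous estimator upgraded to the better side information. -/
theorem IsAdmissible.exists_estimator (h : IsAdmissible Q sqDist D μ X Y W)
    (hQ : IsGaussianDegradedLaw σ s Q) (hσ : 0 < σ) (hs0 : 0 ≤ s 0) (hs : StrictMono s)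
    (hD : ∀ i, 0 < D i) (i : Fin (m + 1)) :
    ∃ φ : ℝ × (∀ j : {j // j ≤ i}, 𝒲 j) → ℝ, Measurable φ ∧
      ∫⁻ ω, ENNReal.ofReal ((X ω - φ (Y i ω, layersLE W i ω)) ^ 2) ∂μ ≤
        ENNReal.ofReal (V σ s D i) := by
  have hX := h.measurable_X
  have hY := h.measurable_Y
  have hW := h.measurable_W
  have hWi : ∀ i, Measurable (layersLE W i) := by unfold layersLE; fun_prop
  induction i using Fin.induction with
  | zero =>
    rw [V_zero]
    rcases min_choice ((((σ : ℝ) ^ 2)⁻¹ + s 0)⁻¹) (D 0) with hmin | hmin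
    · obtain ⟨ψ, hψ, hle⟩ := exists_estimator_gaussianPair hσ hs0 hX (hY 0)
        (map_pair_eq_gaussianPair hQ hX hY h.law 0)
      rw [hmin]
      exact ⟨fun p => ψ p.1, by fun_prop, hle⟩
    · rw [hmin]
      exact h.distortion 0
  | succ i ih =>
    rw [V_succ]
    rcases min_choice (((V σ s D i.castSucc)⁻¹ + s i.succ - s i.castSucc)⁻¹) (D i.succ)
      with hmin | hmin
    · obtain ⟨φ, hφ, hle⟩ := ih
      have hsi : 0 ≤ s i.castSucc := hs0.trans (hs.monotone (Fin.zero_le _))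
      obtain ⟨ψ, hψ, hle⟩ := exists_estimator_of_isSideInfo hX (hWi _) (hY _) (hY _)
        (h.isSideInfo hQ _ i.castSucc) (h.isSideInfo hQ _ i.succ) hsi
        (hs (Fin.castSucc_lt_succ (i := i))) hφ (V_pos hσ hs0 hs hD _) hle
      rw [hmin]
      exact ⟨fun p => ψ (p.1, fun j => p.2 ⟨j, j.2.trans (Fin.castSucc_lt_succ (i := i)).le⟩),
        by fun_prop, hle⟩
    · rw [hmin]
      exact h.distortion i.succ

/-- Converse: no admissible choice of auxiliary variables beats the Gaussian rate. -/
theorem IsAdmissible.gaussianRate_le (h : IsAdmissible Q sqDist D μ X Y W)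
    (hQ : IsGaussianDegradedLaw σ s Q) (hσ : 0 < σ) (hs0 : 0 ≤ s 0) (hs : StrictMono s)
    (hD : ∀ i, 0 < D i) : ENNReal.ofReal (gaussianRate σ s D) ≤ layeredRate μ X Y W := by
  have hX := h.measurable_X
  have hY := h.measurable_Y
  have hW := h.measurable_W
  have hWi : ∀ i, Measurable (layersLE W i) := by unfold layersLE; fun_prop
  have hσ' : (0 : ℝ) < σ := hσ
  have hV := V_pos hσ hs0 hs hD
  have hinc : ∀ i : Fin m, 0 < s i.succ - s i.castSucc := fun i =>
    sub_pos.2 (hs (Fin.castSucc_lt_succ (i := i)))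
  have hobs : ∀ i, Measurable (obsLE Y W i) := fun i => by unfold obsLE; fun_prop
  have hpair := map_pair_eq_gaussianPair hQ hX hY h.law
  -- No layer precedes the first one, so this observation is a function of `Y 0`.
  have hbase : mutualInfo X (obsLT Y W 0) μ ≤
      ENNReal.ofReal (1 / 2 * Real.log (1 + s 0 * (σ : ℝ) ^ 2)) := by
    refine le_trans ?_ (mutualInfo_gaussianPair_le hs0 hX (hY 0) (hpair 0))
    have e := mutualInfo_comp_le (μ := μ) hX (hY 0)
      (f := fun y => ((y, fun j => absurd j.2 (Fin.not_lt_zero _)) :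
        ℝ × (∀ j : {j : Fin (m + 1) // j < 0}, 𝒲 j))) (by
        refine Measurable.prodMk measurable_id (measurable_pi_iff.2 fun j => ?_)
        exact absurd j.2 (Fin.not_lt_zero _))
    refine le_trans (le_of_eq ?_) e
    congr 1
    funext ω
    refine Prod.ext rfl (funext fun j => ?_)
    exact absurd j.2 (Fin.not_lt_zero _)
  have hmid : ∀ i : Fin m, mutualInfo X (obsLT Y W i.succ) μ ≤
      mutualInfo X (obsLE Y W i.castSucc) μ + ENNReal.ofReal (1 / 2 *
        Real.log (1 + (s i.succ - s i.castSucc) * V σ s D i.castSucc)) := by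
    intro i
    obtain ⟨φ, hφ, hle⟩ := h.exists_estimator hQ hσ hs0 hs hD i.castSucc
    have hsi : 0 ≤ s i.castSucc := hs0.trans (hs.monotone (Fin.zero_le _))
    refine le_trans ?_ (mutualInfo_le_of_isSideInfo hX (hWi i.castSucc) (hY _) (hY _)
      (h.isSideInfo hQ _ i.castSucc) (h.isSideInfo hQ _ i.succ) hsi
      (hs (Fin.castSucc_lt_succ (i := i))) hφ (hV _).le hle)
    exact mutualInfo_comp_le (μ := μ) (X := X) (U := fun ω => (Y i.succ ω, layersLE W i.castSucc ω))
      hX (by fun_prop) (f := fun p => (p.1, fun j : {j // j < i.succ} =>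
        p.2 ⟨j, Fin.le_castSucc_iff.2 j.2⟩)) (by fun_prop)
  have hsum := le_add_sum_of_step
    (fun i => condMutualInfo X (W i) (obsLT Y W i) μ) (fun i => mutualInfo X (obsLE Y W i) μ)
    (fun i => ENNReal.ofReal (1 / 2 *
        Real.log (1 + (s i.succ - s i.castSucc) * V σ s D i.castSucc)))
    (ENNReal.ofReal (1 / 2 * Real.log (1 + s 0 * (σ : ℝ) ^ 2)))
    ((mutualInfo_obsLE_le hX hY hW 0).trans (by gcongr))
    (fun i => (mutualInfo_obsLE_le hX hY hW i.succ).trans (by gcongr; exact hmid i))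
  obtain ⟨φ, hφ, hle⟩ := h.exists_estimator hQ hσ hs0 hs hD (Fin.last m)
  have hlow := le_mutualInfo_of_gaussian hX (U := obsLE Y W (Fin.last m)) (hobs _)
    (by positivity) (gaussianPair_decomposition hX (hY 0) (hpair 0)).1 hφ (hV (Fin.last m)) hle
  have hlogn : ∀ i : Fin m,
      0 ≤ 1 / 2 * Real.log (1 + (s i.succ - s i.castSucc) * V σ s D i.castSucc) := fun i => by
    have := mul_pos (hinc i) (hV i.castSucc)
    have := Real.log_nonneg (x := 1 + (s i.succ - s i.castSucc) * V σ s D i.castSucc) (by linarith)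
    positivity
  have hlog0 : 0 ≤ 1 / 2 * Real.log (1 + s 0 * (σ : ℝ) ^ 2) := by
    have := Real.log_nonneg (x := 1 + s 0 * (σ : ℝ) ^ 2) (by nlinarith [sq_nonneg (σ : ℝ)])
    positivity
  rw [← ENNReal.ofReal_sum_of_nonneg (fun i _ => hlogn i),
    ← ENNReal.ofReal_add hlog0 (Finset.sum_nonneg fun i _ => hlogn i)] at hsum
  -- The formula is the information required at the end minus that supplied by the side information;
  -- the two occurrences of log σ² cancel.
  have hrate : gaussianRate σ s D = 1 / 2 * Real.log (((σ ^ 2 : ℝ≥0) : ℝ) / V σ s D (Fin.last m)) -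
      (1 / 2 * Real.log (1 + s 0 * (σ : ℝ) ^ 2) + ∑ i : Fin m,
        1 / 2 * Real.log (1 + (s i.succ - s i.castSucc) * V σ s D i.castSucc)) := by
    rw [log_one_add_mul_sq hσ hs0, NNReal.coe_pow, Real.log_div (by positivity) (hV _).ne',
      ← Finset.mul_sum, gaussianRate]
    ring
  rw [hrate, ENNReal.ofReal_sub _ (add_nonneg hlog0 (Finset.sum_nonneg fun i _ => hlogn i)),
    tsub_le_iff_left]
  exact hlow.trans hsum

end Admissible

end Converse

/-! ### Linear combinations of independent Gaussian variables -/

section GaussianCombinations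

variable {Ω ι κ : Type} [MeasurableSpace Ω] {μ : Measure Ω}

theorem hasGaussianLaw_of_map_eq {X : Ω → ℝ} {v : ℝ≥0} (hX : Measurable X)
    (h : μ.map X = gaussianReal 0 v) : HasGaussianLaw X μ :=
  HasLaw.hasGaussianLaw (μ := gaussianReal 0 v) ⟨hX.aemeasurable, h⟩

/-- Adjoin an independent Gaussian variable to an independent Gaussian family. -/
theorem iIndepFun_option_gaussian [Fintype ι] {f : Ω → ℝ} {g : ι → Ω → ℝ} {v : ℝ≥0} {w : ι → ℝ≥0}
    (hf : Measurable f) (hg : ∀ i, Measurable (g i)) (hlf : μ.map f = gaussianReal 0 v)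
    (hlg : ∀ i, μ.map (g i) = gaussianReal 0 (w i)) (hind : iIndepFun g μ)
    (h : IndepFun f (fun ω i => g i ω) μ) :
    iIndepFun (fun o : Option ι => o.elim f g) μ := by
  have hG : HasGaussianLaw (fun ω => (f ω, fun i => g i ω)) μ :=
    IndepFun.hasGaussianLaw (hasGaussianLaw_of_map_eq hf hlf)
      (iIndepFun.hasGaussianLaw (fun k => hasGaussianLaw_of_map_eq (hg k) (hlg k)) hind) h
  let L : ℝ × (ι → ℝ) →L[ℝ] (Option ι → ℝ) := ContinuousLinearMap.pi fun o =>
    o.elim (ContinuousLinearMap.fst ℝ ℝ (ι → ℝ))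
      fun i => (ContinuousLinearMap.proj i).comp (ContinuousLinearMap.snd ℝ ℝ (ι → ℝ))
  have hL := hG.map_fun L
  have e : (fun ω => L (f ω, fun i => g i ω)) =
      fun ω (o : Option ι) => (fun o : Option ι => o.elim f g) o ω := by
    funext ω o
    cases o <;> simp [L]
  rw [e] at hL
  have hfg : ∀ i, cov[f, g i; μ] = 0 := fun i =>
    IndepFun.covariance_eq_zero (h.comp measurable_id (measurable_pi_apply i))
      (moments_of_map_eq_gaussianReal hf hlf).1 (moments_of_map_eq_gaussianReal (hg i) (hlg i)).1
  refine HasGaussianLaw.iIndepFun_of_covariance_eq_zero hL fun i j hij => ?_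
  cases i <;> cases j
  · exact absurd rfl hij
  · exact hfg _
  · exact (covariance_comm _ _).trans (hfg _)
  · exact (hind.indepFun (by simpa using hij)).covariance_eq_zero
      (moments_of_map_eq_gaussianReal (hg _) (hlg _)).1
      (moments_of_map_eq_gaussianReal (hg _) (hlg _)).1

variable [IsProbabilityMeasure μ] [Fintype ι] [Fintype κ]

/-- Uncorrelated linear combinations of independent centred Gaussian variables are independent. -/
theorem indepFun_gaussian_combination {ξ : κ → Ω → ℝ} {v : κ → ℝ≥0} (hξ : ∀ k, Measurable (ξ k))
    (hlaw : ∀ k, μ.map (ξ k) = gaussianReal 0 (v k)) (hind : iIndepFun ξ μ) (α : κ → ℝ)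
    (β : ι → κ → ℝ) (h0 : ∀ i, ∑ k, α k * β i k * v k = 0) :
    IndepFun (fun ω => ∑ k, α k * ξ k ω) (fun ω i => ∑ k, β i k * ξ k ω) μ ∧
      MemLp (fun ω => ∑ k, α k * ξ k ω) 2 μ ∧ ∫ ω, ∑ k, α k * ξ k ω ∂μ = 0 ∧
      ∫ ω, (∑ k, α k * ξ k ω) ^ 2 ∂μ = ∑ k, α k ^ 2 * v k := by
  classical
  have hmom := fun k => moments_of_map_eq_gaussianReal (hξ k) (hlaw k)
  have hcov : ∀ k l, cov[ξ k, ξ l; μ] = if k = l then (v k : ℝ) else 0 := by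
    intro k l
    split_ifs with hkl
    · subst hkl
      rw [covariance_self (hξ k).aemeasurable,
        variance_of_integral_eq_zero (hξ k).aemeasurable (hmom k).2.1, (hmom k).2.2]
    · exact (hind.indepFun hkl).covariance_eq_zero (hmom k).1 (hmom l).1
  have hcomb : ∀ c d : κ → ℝ, cov[fun ω => ∑ k, c k * ξ k ω, fun ω => ∑ k, d k * ξ k ω; μ] =
      ∑ k, c k * d k * v k := by
    intro c d
    rw [covariance_fun_sum_fun_sum (fun k => (hmom k).1.const_mul (c k))
      (fun k => (hmom k).1.const_mul (d k))]
    simp only [covariance_const_mul_left, covariance_const_mul_right, hcov]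
    refine Finset.sum_congr rfl fun k _ => ?_
    rw [Finset.sum_eq_single k (fun l _ hl => by simp [hl.symm]) (by simp)]
    simp
    ring
  have hG : HasGaussianLaw (fun ω k => ξ k ω) μ :=
    iIndepFun.hasGaussianLaw (fun k => hasGaussianLaw_of_map_eq (hξ k) (hlaw k)) hind
  have hmem : MemLp (fun ω => ∑ k, α k * ξ k ω) 2 μ :=
    memLp_finsetSum _ fun k _ => (hmom k).1.const_mul (α k)
  have hint : ∫ ω, ∑ k, α k * ξ k ω ∂μ = 0 := by
    rw [integral_finsetSum _ fun k _ => ((hmom k).1.integrable (by norm_num)).const_mul (α k)]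
    exact Finset.sum_eq_zero fun k _ => by rw [integral_const_mul, (hmom k).2.1, mul_zero]
  refine ⟨?_, hmem, hint, ?_⟩
  -- The single combination is viewed as a family over `Unit`, since the independence criterion
  -- compares two finite families.
  · let L : (κ → ℝ) →L[ℝ] (Unit → ℝ) × (ι → ℝ) :=
      (ContinuousLinearMap.pi fun _ => ∑ k, α k • ContinuousLinearMap.proj k).prod
        (ContinuousLinearMap.pi fun i => ∑ k, β i k • ContinuousLinearMap.proj k)
    have hL := hG.map_fun L
    have e : (fun ω => L (fun k => ξ k ω)) = fun ω =>
        (fun _ : Unit => ∑ k, α k * ξ k ω, fun i => ∑ k, β i k * ξ k ω) := by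
      funext ω
      ext <;> simp [L]
    rw [e] at hL
    have hI := HasGaussianLaw.indepFun_of_covariance_eval (X := fun _ : Unit => fun ω =>
      ∑ k, α k * ξ k ω) (Y := fun i ω => ∑ k, β i k * ξ k ω) hL
      (fun _ i => by rw [hcomb]; exact h0 i)
    exact hI.comp (measurable_pi_apply ()) measurable_id
  · rw [← variance_of_integral_eq_zero (by fun_prop) hint, ← covariance_self (by fun_prop), hcomb]
    exact Finset.sum_congr rfl fun k _ => by ring

/-- The estimation error of `X` from the observations `q X + Z` and `a_i X + N_i` is independent
of the observations and has variance `(σ⁻² + q² + ∑ a_i²)⁻¹`. -/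
theorem gaussian_estimation_error {σ : ℝ≥0} (hσ : 0 < σ) {X Z : Ω → ℝ} {N : ι → Ω → ℝ}
    (hX : Measurable X) (hZ : Measurable Z) (hN : ∀ i, Measurable (N i))
    (hlX : μ.map X = gaussianReal 0 (σ ^ 2)) (hlZ : μ.map Z = gaussianReal 0 1)
    (hlN : ∀ i, μ.map (N i) = gaussianReal 0 1) (hind : iIndepFun N μ) (hZX : IndepFun Z X μ)
    (h : IndepFun (fun ω i => N i ω) (fun ω => (X ω, Z ω)) μ) (q : ℝ) (a : ι → ℝ) {P : ℝ}
    (hP : P = ((σ : ℝ) ^ 2)⁻¹ + q ^ 2 + ∑ i, a i ^ 2) {E : Ω → ℝ}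
    (hE : E = fun ω => X ω -
      P⁻¹ * (q * (q * X ω + Z ω) + ∑ i, a i * (a i * X ω + N i ω))) :
    IndepFun E (fun ω => (q * X ω + Z ω, fun i => a i * X ω + N i ω)) μ ∧ MemLp E 2 μ ∧
      ∫ ω, E ω ∂μ = 0 ∧ ∫ ω, E ω ^ 2 ∂μ = P⁻¹ := by
  classical
  have hσ' : (0 : ℝ) < σ := hσ
  have hP0 : 0 < P := by rw [hP]; positivity
  have h1 : iIndepFun (fun o : Option ι => o.elim Z N) μ :=
    iIndepFun_option_gaussian hZ hN hlZ hlN hind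
      ((h.comp measurable_id measurable_snd).symm)
  have h2 : iIndepFun (fun o : Option (Option ι) => o.elim X fun o => o.elim Z N) μ := by
    refine iIndepFun_option_gaussian (w := fun _ => 1) hX ?_ hlX ?_ h1 ?_
    · rintro (_ | i)
      exacts [hZ, hN i]
    · rintro (_ | i)
      exacts [hlZ, hlN i]
    · have hi := IndepFun.assoc (p := fun ω i => N i ω) (a := Z) (b := X) (by fun_prop) hZ hX
        (h.comp (φ := id) (ψ := Prod.swap) measurable_id measurable_swap) hZX
      have hm : Measurable (fun (p : (ι → ℝ) × ℝ) (o : Option ι) => o.elim p.2 p.1) := by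
        refine measurable_pi_iff.2 ?_
        rintro (_ | i)
        · exact measurable_snd
        · exact (measurable_pi_apply i).comp measurable_fst
      have hc := hi.comp measurable_id hm
      have e : (fun ω (o : Option ι) => Option.elim o Z N ω) =
          (fun (p : (ι → ℝ) × ℝ) (o : Option ι) => o.elim p.2 p.1) ∘
            fun ω => (fun i => N i ω, Z ω) := by
        funext ω o
        cases o <;> rfl
      rw [e]
      exact hc
  -- The coefficients expand the error in the independent variables X, Z, N_i, as P⁻¹ (σ⁻² X - q Z -
  -- ∑ a_i N_i). Against q X + Z the covariance is P⁻¹ (q - q), and likewise for each a_i X + N_i.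
  have key := indepFun_gaussian_combination (μ := μ)
    (ξ := fun o : Option (Option ι) => o.elim X fun o => o.elim Z N)
    (v := fun o : Option (Option ι) => o.elim (σ ^ 2) fun _ => 1)
    (by rintro (_ | _ | i); exacts [hX, hZ, hN i])
    (by rintro (_ | _ | i); exacts [hlX, hlZ, hlN i]) h2
    (fun o => o.elim (P⁻¹ * ((σ : ℝ) ^ 2)⁻¹) fun o => o.elim (-(P⁻¹ * q)) fun i => -(P⁻¹ * a i))
    (fun (j : Option ι) o => o.elim (j.elim q a) fun o => if o = j then 1 else 0) (by
      rintro (_ | j)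
      · simp [Fintype.sum_option]
        field_simp
        simp
      · simp [Fintype.sum_option]
        field_simp
        simp)
  simp only [Fintype.sum_option, Option.elim] at key
  have eE : E = fun ω => P⁻¹ * ((σ : ℝ) ^ 2)⁻¹ * X ω +
      (-(P⁻¹ * q) * Z ω + ∑ i, -(P⁻¹ * a i) * N i ω) := by
    funext ω
    have e1 : ∑ i, a i * (a i * X ω + N i ω) = (∑ i, a i ^ 2) * X ω + ∑ i, a i * N i ω := by
      rw [Finset.sum_mul, ← Finset.sum_add_distrib]
      exact Finset.sum_congr rfl fun i _ => by ring
    have e2 : ∑ i, -(P⁻¹ * a i) * N i ω = -P⁻¹ * ∑ i, a i * N i ω := by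
      rw [Finset.mul_sum]
      exact Finset.sum_congr rfl fun i _ => by ring
    have e3 : ∑ i, a i ^ 2 = P - ((σ : ℝ) ^ 2)⁻¹ - q ^ 2 := by rw [hP]; ring
    rw [hE]
    simp only [e1, e2, e3]
    have : P⁻¹ * P = 1 := inv_mul_cancel₀ hP0.ne'
    linear_combination (-X ω) * this
  rw [← eE] at key
  obtain ⟨k1, k2, k3, k4⟩ := key
  refine ⟨?_, k2, ?_, ?_⟩
  · have hm : Measurable (fun f : Option ι → ℝ => (f none, fun i => f (some i))) := by fun_prop
    have hc := k1.comp measurable_id hm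
    refine hc.congr (ae_of_all _ fun ω => rfl) (ae_of_all _ fun ω => ?_)
    simp
  · exact k3
  · rw [eE]
    refine k4.trans ?_
    have e4 : ∑ i, (-(P⁻¹ * a i)) ^ 2 * ((1 : ℝ≥0) : ℝ) = P⁻¹ ^ 2 * ∑ i, a i ^ 2 := by
      rw [Finset.mul_sum]
      exact Finset.sum_congr rfl fun i _ => by push_cast; ring
    have e5 : ∑ i, a i ^ 2 = P - ((σ : ℝ) ^ 2)⁻¹ - q ^ 2 := by rw [hP]; ring
    rw [e4, e5]
    push_cast
    field_simp
    ring

end GaussianCombinations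

/-! ### Precisions of the Gaussian scheme -/

section Precisions

variable {m : ℕ} {σ : ℝ≥0} {s D : Fin (m + 1) → ℝ}

theorem coeff_sq (hσ : 0 < σ) (hs0 : 0 ≤ s 0) (hs : StrictMono s) (hD : ∀ i, 0 < D i)
    (i : Fin (m + 1)) : coeff σ s D i ^ 2 = (V σ s D i)⁻¹ - (priorV σ s D i)⁻¹ := by
  refine Real.sq_sqrt (sub_nonneg.2 ?_)
  refine inv_anti₀ (V_pos hσ hs0 hs hD i) ?_
  rw [V_eq_min]
  exact min_le_left _ _

theorem inv_V_eq_inv_priorV_add (hσ : 0 < σ) (hs0 : 0 ≤ s 0) (hs : StrictMono s)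
    (hD : ∀ i, 0 < D i) (i : Fin (m + 1)) :
    (V σ s D i)⁻¹ = (priorV σ s D i)⁻¹ + coeff σ s D i ^ 2 := by
  rw [coeff_sq hσ hs0 hs hD]
  ring

/-- Unrolled recursion: each layer adds its squared gain and each change of state adds s_{i+1} -
s_i, which telescopes. This is the form produced by `gaussian_estimation_error`. -/
theorem inv_priorV_eq (hσ : 0 < σ) (hs0 : 0 ≤ s 0) (hs : StrictMono s) (hD : ∀ i, 0 < D i)
    (i : Fin (m + 1)) : (priorV σ s D i)⁻¹ =
      ((σ : ℝ) ^ 2)⁻¹ + s i + ∑ j : {j // j < i}, coeff σ s D j ^ 2 := by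
  rw [← Finset.sum_subtype (Finset.Iio i) (fun j => Finset.mem_Iio)
    (fun j => coeff σ s D j ^ 2)]
  induction i using Fin.induction with
  | zero =>
    have : Finset.Iio (0 : Fin (m + 1)) = ∅ := by ext j; simp
    rw [priorV_zero, inv_inv, this, Finset.sum_empty, add_zero]
  | succ i ih =>
    have : Finset.Iio i.succ = insert i.castSucc (Finset.Iio i.castSucc) := by
      rw [Finset.Iio_insert]
      ext j
      simp [Fin.le_castSucc_iff]
    rw [priorV_succ, inv_inv, inv_V_eq_inv_priorV_add hσ hs0 hs hD, ih, this,
      Finset.sum_insert (by simp)]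
    ring

theorem inv_V_eq (hσ : 0 < σ) (hs0 : 0 ≤ s 0) (hs : StrictMono s) (hD : ∀ i, 0 < D i)
    (i : Fin (m + 1)) : (V σ s D i)⁻¹ =
      ((σ : ℝ) ^ 2)⁻¹ + s i + ∑ j : {j // j ≤ i}, coeff σ s D j ^ 2 := by
  rw [inv_V_eq_inv_priorV_add hσ hs0 hs hD, inv_priorV_eq hσ hs0 hs hD,
    ← Finset.sum_subtype (Finset.Iio i) (fun j => Finset.mem_Iio) (fun j => coeff σ s D j ^ 2),
    ← Finset.sum_subtype (Finset.Iic i) (fun j => Finset.mem_Iic) (fun j => coeff σ s D j ^ 2),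
    ← Finset.Iio_insert, Finset.sum_insert (by simp)]
  ring

theorem one_add_coeff_sq_mul_priorV (hσ : 0 < σ) (hs0 : 0 ≤ s 0) (hs : StrictMono s)
    (hD : ∀ i, 0 < D i) (i : Fin (m + 1)) :
    1 + coeff σ s D i ^ 2 * priorV σ s D i = priorV σ s D i / V σ s D i := by
  have := (priorV_pos hσ hs0 hs hD i).ne'
  have := (V_pos hσ hs0 hs hD i).ne'
  rw [coeff_sq hσ hs0 hs hD]
  field_simp
  ring

end Precisions

/-! ### Achievability by Gaussian layers -/

section Achievability

/-- If the error `X - φ(T)` of an unbiased estimator is independent of the observation `T`, the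
conditional variance of `X` given `T` is the mean squared error. -/
theorem condVar_of_indepFun_error {Ω 𝒯 : Type} [MeasurableSpace Ω] [MeasurableSpace 𝒯]
    {μ : Measure Ω} [IsProbabilityMeasure μ] {X : Ω → ℝ} {T : Ω → 𝒯} (hX : Measurable X)
    (hT : Measurable T) (hX2 : MemLp X 2 μ) {φ : 𝒯 → ℝ} (hφ : Measurable φ)
    (hE : MemLp (fun ω => X ω - φ (T ω)) 2 μ)
    (hind : IndepFun (fun ω => X ω - φ (T ω)) T μ)
    (h0 : ∫ ω, (X ω - φ (T ω)) ∂μ = 0) {v : ℝ} (hv : ∫ ω, (X ω - φ (T ω)) ^ 2 ∂μ = v) :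
    Var[X; μ | MeasurableSpace.comap T inferInstance] =ᵐ[μ] fun _ => v := by
  have hEm : Measurable fun ω => X ω - φ (T ω) := by fun_prop
  have hcE : μ[fun ω => X ω - φ (T ω) | MeasurableSpace.comap T inferInstance] =ᵐ[μ] fun _ => 0 := by
    have := condExp_indep_eq (μ := μ) hEm.comap_le hT.comap_le
      (comap_measurable (fun ω => X ω - φ (T ω))).stronglyMeasurable hind
    rwa [h0] at this
  have hcS : μ[fun ω => (X ω - φ (T ω)) ^ 2 | MeasurableSpace.comap T inferInstance]
      =ᵐ[μ] fun _ => v := by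
    have := condExp_indep_eq (μ := μ) (f := fun ω => (X ω - φ (T ω)) ^ 2) hEm.comap_le hT.comap_le
      ((comap_measurable (fun ω => X ω - φ (T ω))).pow_const 2).stronglyMeasurable hind
    rwa [hv] at this
  have hφi : Integrable (fun ω => φ (T ω)) μ := by
    have := (hX2.integrable (by norm_num)).sub (hE.integrable (by norm_num))
    refine this.congr (ae_of_all _ fun ω => ?_)
    simp
  have hcX : μ[X | MeasurableSpace.comap T inferInstance] =ᵐ[μ] fun ω => φ (T ω) := by
    have e : X = (fun ω => X ω - φ (T ω)) + fun ω => φ (T ω) := by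
      funext ω
      simp
    have h1 := condExp_add (hE.integrable (by norm_num)) hφi (MeasurableSpace.comap T inferInstance)
    rw [← e] at h1
    have h2 := condExp_of_stronglyMeasurable hT.comap_le
      (hφ.comp (comap_measurable T)).stronglyMeasurable hφi
    filter_upwards [h1, hcE] with ω h1 h3
    rw [h1, Pi.add_apply, h3, zero_add]
    exact congrFun h2 ω
  refine Filter.EventuallyEq.trans (condExp_congr_ae ?_) hcS
  filter_upwards [hcX] with ω hω
  simp [hω]

variable {Ω : Type} [MeasurableSpace Ω] {μ : Measure Ω} [IsProbabilityMeasure μ] {m : ℕ}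
  {σ : ℝ≥0} {s D : Fin (m + 1) → ℝ} {Q : Measure (ℝ × (Fin (m + 1) → ℝ))} [IsProbabilityMeasure Q]
  {X : Ω → ℝ} {Y N : Fin (m + 1) → Ω → ℝ}

/-- The predicate `p` selects the layers in use: `j < i` gives the error before layer i, which
bounds the rate, and `j ≤ i` the error after it, which gives distortion and conditional variance. -/
theorem exists_gaussian_estimator (hQ : IsGaussianDegradedLaw σ s Q) (hσ : 0 < σ) (hs0 : 0 ≤ s 0)
    (hs : StrictMono s) (hX : Measurable X) (hY : ∀ i, Measurable (Y i))
    (hN : ∀ i, Measurable (N i)) (hlaw : μ.map (fun ω => (X ω, fun i => Y i ω)) = Q)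
    (hlN : ∀ i, μ.map (N i) = gaussianReal 0 1) (hiid : iIndepFun N μ)
    (hind : IndepFun (fun ω i => N i ω) (fun ω => (X ω, fun i => Y i ω)) μ)
    (i : Fin (m + 1)) (p : Fin (m + 1) → Prop) [DecidablePred p] (a : Fin (m + 1) → ℝ) {v : ℝ}
    (hv : v⁻¹ = ((σ : ℝ) ^ 2)⁻¹ + s i + ∑ j : {j // p j}, a j ^ 2) :
    ∃ φ : ℝ × ({j // p j} → ℝ) → ℝ, Measurable φ ∧
      IndepFun (fun ω => X ω - φ (Y i ω, fun j => a j * X ω + N j ω))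
        (fun ω => (Y i ω, fun j : {j // p j} => a j * X ω + N j ω)) μ ∧
      MemLp (fun ω => X ω - φ (Y i ω, fun j => a j * X ω + N j ω)) 2 μ ∧
      ∫ ω, (X ω - φ (Y i ω, fun j => a j * X ω + N j ω)) ∂μ = 0 ∧
      ∫ ω, (X ω - φ (Y i ω, fun j => a j * X ω + N j ω)) ^ 2 ∂μ = v := by
  obtain ⟨h1, h2, h3⟩ := gaussianPair_decomposition hX (hY i)
    (map_pair_eq_gaussianPair hQ hX hY hlaw i)
  have hsi : 0 ≤ s i := hs0.trans (hs.monotone (Fin.zero_le _))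
  have hm1 : Measurable (fun (n : Fin (m + 1) → ℝ) (j : {j // p j}) => n j) := by fun_prop
  have hm2 : Measurable (fun q : ℝ × (Fin (m + 1) → ℝ) => (q.1, q.2 i - √(s i) * q.1)) := by
    fun_prop
  have key := gaussian_estimation_error (μ := μ) hσ (N := fun j : {j // p j} => N j) hX
    (Z := fun ω => Y i ω - √(s i) * X ω) (by fun_prop) (fun j => hN j) h1 h2 (fun j => hlN j)
    (hiid.precomp Subtype.val_injective) h3 (hind.comp hm1 hm2) (√(s i)) (fun j => a j)
    (P := v⁻¹) (by rw [hv, Real.sq_sqrt hsi]) rfl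
  simp only [add_sub_cancel, inv_inv] at key
  exact ⟨fun t => v * (√(s i) * t.1 + ∑ j : {j // p j}, a j * t.2 j), by fun_prop, key⟩

theorem indepFun_noise_obsLT (hX : Measurable X) (hY : ∀ i, Measurable (Y i))
    (hN : ∀ i, Measurable (N i)) (hiid : iIndepFun N μ)
    (hind : IndepFun (fun ω i => N i ω) (fun ω => (X ω, fun i => Y i ω)) μ) (i : Fin (m + 1)) :
    IndepFun (N i) (fun ω => (obsLT Y (gaussianAux σ s D X N) i ω, X ω)) μ := by
  have hlt : IndepFun (fun ω (j : {j // j < i}) => N j ω) (N i) μ := by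
    have h := hiid.indepFun_finset (Finset.Iio i) {i} (by simp) hN
    have hm1 : Measurable (fun (f : Finset.Iio i → ℝ) (j : {j // j < i}) =>
        f ⟨j, Finset.mem_Iio.2 j.2⟩) := by fun_prop
    have hm2 : Measurable (fun f : ({i} : Finset (Fin (m + 1))) → ℝ =>
        f ⟨i, Finset.mem_singleton_self i⟩) := by fun_prop
    exact h.comp hm1 hm2
  have hm : Measurable (fun n : Fin (m + 1) → ℝ => ((fun j : {j // j < i} => n j), n i)) := by
    fun_prop
  have h := IndepFun.assoc (by fun_prop) (by fun_prop) (hN i) (hind.symm.comp measurable_id hm) hlt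
  have hg : Measurable (fun p : (ℝ × (Fin (m + 1) → ℝ)) × ({j // j < i} → ℝ) =>
      ((p.1.2 i, fun j : {j // j < i} => coeff σ s D j * p.1.1 + p.2 j), p.1.1)) := by fun_prop
  exact h.comp measurable_id hg

/-- Layer i is a Gaussian observation with gain a_i of a source already known up to error `priorV`.
Only the upper bound is proved directly. -/
theorem condMutualInfo_gaussianAux_le (hQ : IsGaussianDegradedLaw σ s Q) (hσ : 0 < σ)
    (hs0 : 0 ≤ s 0) (hs : StrictMono s) (hD : ∀ i, 0 < D i) (hX : Measurable X)
    (hY : ∀ i, Measurable (Y i))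
    (hN : ∀ i, Measurable (N i)) (hlaw : μ.map (fun ω => (X ω, fun i => Y i ω)) = Q)
    (hlN : ∀ i, μ.map (N i) = gaussianReal 0 1) (hiid : iIndepFun N μ)
    (hind : IndepFun (fun ω i => N i ω) (fun ω => (X ω, fun i => Y i ω)) μ)
    (i : Fin (m + 1)) :
    condMutualInfo X (gaussianAux σ s D X N i) (obsLT Y (gaussianAux σ s D X N) i) μ ≤
      ENNReal.ofReal (1 / 2 * Real.log (priorV σ s D i / V σ s D i)) := by
  obtain ⟨φ, hφ, -, h2, -, h4⟩ := exists_gaussian_estimator hQ hσ hs0 hs hX hY hN hlaw hlN hiid hind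
    i (fun j => j < i) (coeff σ s D) (inv_priorV_eq hσ hs0 hs hD i)
  have hobs : Measurable (obsLT Y (gaussianAux σ s D X N) i) := by
    unfold obsLT gaussianAux
    fun_prop
  rw [← one_add_coeff_sq_mul_priorV hσ hs0 hs hD]
  refine condMutualInfo_add_noise_le hX (hN i) hobs (hlN i)
    (indepFun_noise_obsLT hX hY hN hiid hind i) _ hφ (priorV_pos hσ hs0 hs hD i).le ?_
  refine le_of_eq ((ofReal_integral_eq_lintegral_ofReal h2.integrable_sq
    (ae_of_all _ fun ω => sq_nonneg _)).symm.trans ?_)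
  rw [h4]

theorem isAdmissible_gaussianAux [StandardBorelSpace Ω] (hQ : IsGaussianDegradedLaw σ s Q)
    (hσ : 0 < σ) (hs0 : 0 ≤ s 0) (hs : StrictMono s) (hD : ∀ i, 0 < D i) (hX : Measurable X)
    (hY : ∀ i, Measurable (Y i))
    (hN : ∀ i, Measurable (N i)) (hlaw : μ.map (fun ω => (X ω, fun i => Y i ω)) = Q)
    (hlN : ∀ i, μ.map (N i) = gaussianReal 0 1) (hiid : iIndepFun N μ)
    (hind : IndepFun (fun ω i => N i ω) (fun ω => (X ω, fun i => Y i ω)) μ) :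
    IsAdmissible Q sqDist D μ X Y (gaussianAux σ s D X N) where
  measurable_X := hX
  measurable_Y := hY
  measurable_W i := by
    unfold gaussianAux
    fun_prop
  law := hlaw
  markov_X := by
    -- Given `X`, the variable `X` itself is trivially independent of the side information;
    -- adjoining the noises yields `W`.
    have h0 : CondIndepFun (MeasurableSpace.comap X inferInstance) hX.comap_le X
        (fun ω i => Y i ω) μ := condIndepFun_self_left (by fun_prop) hX
    have hm : Measurable (fun q : ℝ × (Fin (m + 1) → ℝ) => ((q.1, q.1), q.2)) := by fun_prop
    have h1 := CondIndepFun.prodMk_of_indepFun (by fun_prop) hX hX (by fun_prop) h0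
      (hind.comp measurable_id hm)
    have hm' : Measurable (fun (q : ℝ × (Fin (m + 1) → ℝ)) i => coeff σ s D i * q.1 + q.2 i) := by
      fun_prop
    exact h1.comp hm' measurable_id
  markov_Y i := by
    -- Degradedness of `Q` transported to `Ω`; the noises of the layers are then adjoined on the
    -- side of `X`.
    have h0 : CondIndepFun (MeasurableSpace.comap (Y i) inferInstance) (hY i).comap_le
        (fun ω => (X ω, fun j : {j // i < j} => Y j ω)) (fun ω (j : {j // j < i}) => Y j ω) μ := by
      refine (condIndepFun_iff_of_law_eq (μ' := Q) (by fun_prop) (by fun_prop) (hY i)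
        (by fun_prop) (by fun_prop) ((measurable_pi_apply i).comp measurable_snd) ?_).2
        (hQ.degraded i)
      rw [← hlaw, Measure.map_map (by fun_prop) (by fun_prop)]
      rfl
    have hm : Measurable (fun q : ℝ × (Fin (m + 1) → ℝ) =>
        ((q.2 i, (q.1, fun j : {j // i < j} => q.2 j)), fun j : {j // j < i} => q.2 j)) := by
      fun_prop
    have h1 := CondIndepFun.prodMk_of_indepFun (by fun_prop) (by fun_prop) (hY i) (by fun_prop) h0
      (hind.comp measurable_id hm)
    have hm' : Measurable (fun q : (ℝ × ({j // i < j} → ℝ)) × (Fin (m + 1) → ℝ) =>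
        (((fun i => coeff σ s D i * q.1.1 + q.2 i), q.1.1), q.1.2)) := by fun_prop
    exact h1.comp hm' measurable_id
  distortion i := by
    obtain ⟨φ, hφ, -, h2, -, h4⟩ := exists_gaussian_estimator hQ hσ hs0 hs hX hY hN hlaw hlN hiid
      hind i (fun j => j ≤ i) (coeff σ s D) (inv_V_eq hσ hs0 hs hD i)
    refine ⟨φ, hφ, ?_⟩
    refine le_trans (le_of_eq ((ofReal_integral_eq_lintegral_ofReal h2.integrable_sq
      (ae_of_all _ fun ω => sq_nonneg _)).symm)) (ENNReal.ofReal_le_ofReal ?_)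
    rw [h4, V_eq_min]
    exact min_le_right _ _

theorem condVar_gaussianAux (hQ : IsGaussianDegradedLaw σ s Q) (hσ : 0 < σ)
    (hs0 : 0 ≤ s 0) (hs : StrictMono s) (hD : ∀ i, 0 < D i) (hX : Measurable X)
    (hY : ∀ i, Measurable (Y i))
    (hN : ∀ i, Measurable (N i)) (hlaw : μ.map (fun ω => (X ω, fun i => Y i ω)) = Q)
    (hlN : ∀ i, μ.map (N i) = gaussianReal 0 1) (hiid : iIndepFun N μ)
    (hind : IndepFun (fun ω i => N i ω) (fun ω => (X ω, fun i => Y i ω)) μ)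
    (i : Fin (m + 1)) :
    Var[X; μ | MeasurableSpace.comap (obsLE Y (gaussianAux σ s D X N) i) inferInstance]
      =ᵐ[μ] fun _ => V σ s D i := by
  obtain ⟨φ, hφ, h1, h2, h3, h4⟩ := exists_gaussian_estimator hQ hσ hs0 hs hX hY hN hlaw hlN hiid
    hind i (fun j => j ≤ i) (coeff σ s D) (inv_V_eq hσ hs0 hs hD i)
  have hobs : Measurable (obsLE Y (gaussianAux σ s D X N) i) := by
    unfold obsLE gaussianAux
    fun_prop
  exact condVar_of_indepFun_error hX hobs
    (moments_of_map_eq_gaussianReal hX (gaussianPair_decomposition hX (hY i)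
      (map_pair_eq_gaussianPair hQ hX hY hlaw i)).1).1 hφ h2 h1 h3 h4

theorem half_log_priorV_div_V_nonneg (hσ : 0 < σ) (hs0 : 0 ≤ s 0) (hs : StrictMono s)
    (hD : ∀ i, 0 < D i) (i : Fin (m + 1)) :
    0 ≤ 1 / 2 * Real.log (priorV σ s D i / V σ s D i) := by
  rw [← one_add_coeff_sq_mul_priorV hσ hs0 hs hD]
  have h := (priorV_pos hσ hs0 hs hD i).le
  have := Real.log_nonneg (x := 1 + coeff σ s D i ^ 2 * priorV σ s D i) (by nlinarith [sq_nonneg (coeff σ s D i)])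
  positivity

theorem gaussianRate_nonneg (hσ : 0 < σ) (hs0 : 0 ≤ s 0) (hs : StrictMono s)
    (hD : ∀ i, 0 < D i) : 0 ≤ gaussianRate σ s D := by
  rw [← sum_log_priorV_div_V hσ hs0 hs hD]
  exact Finset.sum_nonneg fun i _ => half_log_priorV_div_V_nonneg hσ hs0 hs hD i

/-- The layerwise upper bounds add up to the formula, and the converse applied to this very scheme
gives the other inequality. -/
theorem layeredRate_gaussianAux [StandardBorelSpace Ω] (hQ : IsGaussianDegradedLaw σ s Q)
    (hσ : 0 < σ) (hs0 : 0 ≤ s 0) (hs : StrictMono s) (hD : ∀ i, 0 < D i) (hX : Measurable X)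
    (hY : ∀ i, Measurable (Y i))
    (hN : ∀ i, Measurable (N i)) (hlaw : μ.map (fun ω => (X ω, fun i => Y i ω)) = Q)
    (hlN : ∀ i, μ.map (N i) = gaussianReal 0 1) (hiid : iIndepFun N μ)
    (hind : IndepFun (fun ω i => N i ω) (fun ω => (X ω, fun i => Y i ω)) μ) :
    layeredRate μ X Y (gaussianAux σ s D X N) = ENNReal.ofReal (gaussianRate σ s D) := by
  refine le_antisymm ?_ ((isAdmissible_gaussianAux hQ hσ hs0 hs hD hX hY hN hlaw hlN hiid
    hind).gaussianRate_le hQ hσ hs0 hs hD)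
  rw [← sum_log_priorV_div_V hσ hs0 hs hD,
    ENNReal.ofReal_sum_of_nonneg fun i _ => half_log_priorV_div_V_nonneg hσ hs0 hs hD i]
  exact Finset.sum_le_sum fun i _ =>
    condMutualInfo_gaussianAux_le hQ hσ hs0 hs hD hX hY hN hlaw hlN hiid hind i

/-- Finite terms bounded one by one, with equal sums, must agree one by one. -/
theorem condMutualInfo_gaussianAux [StandardBorelSpace Ω] (hQ : IsGaussianDegradedLaw σ s Q)
    (hσ : 0 < σ) (hs0 : 0 ≤ s 0) (hs : StrictMono s) (hD : ∀ i, 0 < D i) (hX : Measurable X)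
    (hY : ∀ i, Measurable (Y i))
    (hN : ∀ i, Measurable (N i)) (hlaw : μ.map (fun ω => (X ω, fun i => Y i ω)) = Q)
    (hlN : ∀ i, μ.map (N i) = gaussianReal 0 1) (hiid : iIndepFun N μ)
    (hind : IndepFun (fun ω i => N i ω) (fun ω => (X ω, fun i => Y i ω)) μ)
    (i : Fin (m + 1)) :
    condMutualInfo X (gaussianAux σ s D X N i) (obsLT Y (gaussianAux σ s D X N) i) μ =
      ENNReal.ofReal (1 / 2 * Real.log (priorV σ s D i / V σ s D i)) := by
  have hle := condMutualInfo_gaussianAux_le hQ hσ hs0 hs hD hX hY hN hlaw hlN hiid hind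
  have hsum := layeredRate_gaussianAux hQ hσ hs0 hs hD hX hY hN hlaw hlN hiid hind
  rw [← sum_log_priorV_div_V hσ hs0 hs hD,
    ENNReal.ofReal_sum_of_nonneg fun i _ => half_log_priorV_div_V_nonneg hσ hs0 hs hD i,
    layeredRate] at hsum
  have hfin : ∀ i, condMutualInfo X (gaussianAux σ s D X N i)
      (obsLT Y (gaussianAux σ s D X N) i) μ ≠ ∞ := fun i =>
    ((hle i).trans_lt ENNReal.ofReal_lt_top).ne
  have hsum' := congrArg ENNReal.toReal hsum
  rw [ENNReal.toReal_sum fun i _ => hfin i,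
    ENNReal.toReal_sum fun i _ => ENNReal.ofReal_ne_top] at hsum'
  have h := (Finset.sum_eq_sum_iff_of_le fun i _ =>
    ENNReal.toReal_mono ENNReal.ofReal_ne_top (hle i)).1 hsum' i (Finset.mem_univ i)
  exact (ENNReal.toReal_eq_toReal_iff' (hfin i) ENNReal.ofReal_ne_top).1 h

end Achievability

/-! ### Existence of degraded Gaussian side information -/

section Existence

/-- A sequence of independent standard Gaussian variables, independent of a given variable. -/
theorem iid_gaussian_prod {α : Type} [MeasurableSpace α] (ν : Measure α) [IsProbabilityMeasure ν]
    (n : ℕ) :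
    (∀ j, (ν.prod (Measure.pi fun _ : Fin n => gaussianReal 0 1)).map (fun ω => ω.2 j) =
        gaussianReal 0 1) ∧
      iIndepFun (fun (j : Fin n) (ω : α × (Fin n → ℝ)) => ω.2 j)
        (ν.prod (Measure.pi fun _ : Fin n => gaussianReal 0 1)) ∧
      IndepFun (fun (ω : α × (Fin n → ℝ)) => ω.2) (fun ω => ω.1)
        (ν.prod (Measure.pi fun _ : Fin n => gaussianReal 0 1)) := by
  have hsnd : (ν.prod (Measure.pi fun _ : Fin n => gaussianReal 0 1)).map Prod.snd =
      Measure.pi fun _ : Fin n => gaussianReal 0 1 := by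
    rw [Measure.map_snd_prod, measure_univ, one_smul]
  have hfst : (ν.prod (Measure.pi fun _ : Fin n => gaussianReal 0 1)).map Prod.fst = ν := by
    rw [Measure.map_fst_prod, measure_univ, one_smul]
  have hlaw : ∀ j, (ν.prod (Measure.pi fun _ : Fin n => gaussianReal 0 1)).map (fun ω => ω.2 j) =
      gaussianReal 0 1 := by
    intro j
    have := (measurePreserving_eval (fun _ : Fin n => gaussianReal 0 1) j).map_eq
    rw [← hsnd, Measure.map_map (by fun_prop) (by fun_prop)] at this
    exact this
  refine ⟨hlaw, ?_, ?_⟩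
  · rw [iIndepFun_iff_map_fun_eq_pi_map (by fun_prop)]
    simp only [hlaw]
    exact hsnd
  · refine IndepFun.symm ?_
    rw [indepFun_iff_map_prod_eq_prod_map_map (by fun_prop) (by fun_prop)]
    refine Measure.map_id.trans ?_
    exact congrArg₂ Measure.prod hfst.symm hsnd.symm

variable {m : ℕ}

/-- `s_{i+1}⁻¹`, read as `0` for the last state. -/
def invNext (s : Fin (m + 1) → ℝ) (i : Fin (m + 1)) : ℝ :=
  Fin.lastCases (motive := fun _ => ℝ) 0 (fun j => (s j.succ)⁻¹) i

/-- The standard deviation of the noise private to state `i`. -/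
def innovation (s : Fin (m + 1) → ℝ) (i : Fin (m + 1)) : ℝ :=
  √(1 - s i * invNext s i)

/-- Side information built from the source `x` and the private noises `z`: the observation in
state `i` is a scaled and noisier version of the observation in state `i + 1`. -/
def degradedObs (s : Fin (m + 1) → ℝ) (i : Fin (m + 1)) (x : ℝ) (z : Fin (m + 1) → ℝ) : ℝ :=
  √(s i) * (x + ∑ j ∈ Finset.Ioi i, innovation s j / √(s j) * z j) + innovation s i * z i

theorem measurable_degradedObs (s : Fin (m + 1) → ℝ) (i : Fin (m + 1)) :
    Measurable (fun p : ℝ × (Fin (m + 1) → ℝ) => degradedObs s i p.1 p.2) := by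
  unfold degradedObs
  fun_prop

variable {s : Fin (m + 1) → ℝ}

theorem innovation_sq (hs0 : 0 ≤ s 0) (hs : StrictMono s) (i : Fin (m + 1)) :
    innovation s i ^ 2 = 1 - s i * invNext s i := by
  refine Real.sq_sqrt ?_
  cases i using Fin.lastCases with
  | last => simp [invNext]
  | cast i =>
    have h1 := hs (Fin.castSucc_lt_succ (i := i))
    have h0 : 0 ≤ s i.castSucc := hs0.trans (hs.monotone (Fin.zero_le _))
    simp only [invNext, Fin.lastCases_castSucc]
    rw [sub_nonneg, ← div_eq_mul_inv]
    exact (div_le_one (h0.trans_lt h1)).2 h1.le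

/-- For j > i one has s_j > 0 and the j-th term is 1/s_j - 1/s_{j+1}, so the sum telescopes. The
index i itself is left out because s_i may vanish when i = 0. -/
theorem sum_innovation_sq (hs0 : 0 ≤ s 0) (hs : StrictMono s) (i : Fin (m + 1)) :
    ∑ j ∈ Finset.Ioi i, (innovation s j / √(s j)) ^ 2 = invNext s i := by
  induction i using Fin.reverseInduction with
  | last =>
    have : Finset.Ioi (Fin.last m) = ∅ := by
      ext j
      simpa using Fin.le_last j
    rw [this]
    simp [invNext]
  | cast i ih =>
    have : Finset.Ioi i.castSucc = insert i.succ (Finset.Ioi i.succ) := by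
      rw [Finset.Ioi_insert]
      ext j
      simp [Fin.castSucc_lt_iff_succ_le]
    have hpos : 0 < s i.succ :=
      (hs0.trans (hs.monotone (Fin.zero_le _))).trans_lt (hs (Fin.castSucc_lt_succ (i := i)))
    rw [this, Finset.sum_insert (by simp), ih, div_pow, Real.sq_sqrt hpos.le,
      innovation_sq hs0 hs]
    conv_rhs => simp only [invNext, Fin.lastCases_castSucc]
    field_simp
    ring

theorem degradedObs_congr {i : Fin (m + 1)} {x : ℝ} {z z' : Fin (m + 1) → ℝ}
    (h : ∀ j, i ≤ j → z j = z' j) : degradedObs s i x z = degradedObs s i x z' := by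
  unfold degradedObs
  rw [h i le_rfl, Finset.sum_congr rfl fun j hj => by rw [h j (Finset.mem_Ioi.1 hj).le]]

/-- A weaker observation is a function of a stronger one and of the noises below it. -/
theorem degradedObs_eq (hs0 : 0 ≤ s 0) (hs : StrictMono s) {k i : Fin (m + 1)} (hki : k < i)
    (x : ℝ) (z : Fin (m + 1) → ℝ) : degradedObs s k x z =
      √(s k) * (degradedObs s i x z / √(s i) +
        ∑ j ∈ (Finset.Ioi k).filter (· < i), innovation s j / √(s j) * z j)
        + innovation s k * z k := by
  have hpos : 0 < √(s i) :=
    Real.sqrt_pos.2 ((hs0.trans (hs.monotone (Fin.zero_le k))).trans_lt (hs hki))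
  have hfil : (Finset.Ioi k).filter (fun j => ¬ j < i) = insert i (Finset.Ioi i) := by
    rw [Finset.Ioi_insert]
    ext j
    simp only [Finset.mem_filter, Finset.mem_Ioi, not_lt, Finset.mem_Ici]
    exact ⟨fun h => h.2, fun h => ⟨hki.trans_le h, h⟩⟩
  rw [degradedObs, ← Finset.sum_filter_add_sum_filter_not (Finset.Ioi k) (· < i), hfil,
    Finset.sum_insert (by simp), degradedObs]
  field_simp
  ring

/-- The noise in state i has variance s_i · `invNext` from the higher states plus 1 - s_i ·
`invNext` from its own, which is 1. -/
theorem map_degradedObs {Ω : Type} [MeasurableSpace Ω] {μ : Measure Ω} [IsProbabilityMeasure μ]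
    {σ : ℝ≥0} (hs0 : 0 ≤ s 0) (hs : StrictMono s) {X : Ω → ℝ} {Z : Fin (m + 1) → Ω → ℝ}
    (hX : Measurable X) (hZ : ∀ j, Measurable (Z j)) (hlX : μ.map X = gaussianReal 0 (σ ^ 2))
    (hlZ : ∀ j, μ.map (Z j) = gaussianReal 0 1) (hiid : iIndepFun Z μ)
    (hind : IndepFun (fun ω j => Z j ω) X μ) (i : Fin (m + 1)) :
    μ.map (fun ω => (X ω, degradedObs s i (X ω) fun j => Z j ω)) = gaussianPair σ (s i) := by
  classical
  set c : Fin (m + 1) → ℝ := fun j => if j = i then innovation s i else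
    if i < j then √(s i) * (innovation s j / √(s j)) else 0 with hc
  have hsplit : ∀ g : Fin (m + 1) → ℝ → ℝ, (∀ j, g j 0 = 0) → ∑ j, g j (c j) =
      ∑ j ∈ Finset.Ioi i, g j (√(s i) * (innovation s j / √(s j))) + g i (innovation s i) := by
    intro g hg
    rw [← Finset.sum_subset (Finset.subset_univ (insert i (Finset.Ioi i))),
      Finset.sum_insert (by simp), add_comm]
    · congr 1
      · refine Finset.sum_congr rfl fun j hj => ?_
        have := Finset.mem_Ioi.1 hj
        simp [hc, this, this.ne']
      · simp [hc]
    · intro j _ hj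
      simp only [Finset.mem_insert, Finset.mem_Ioi, not_or] at hj
      simp [hc, hj.1, hj.2, hg]
  have hobs : ∀ ω, degradedObs s i (X ω) (fun j => Z j ω) = √(s i) * X ω + ∑ j, c j * Z j ω := by
    intro ω
    rw [hsplit (fun j t => t * Z j ω) (by simp), degradedObs, mul_add, Finset.mul_sum]
    simp only [mul_assoc]
    ring
  have hsi : 0 ≤ s i := hs0.trans (hs.monotone (Fin.zero_le _))
  have hvar : ∑ j, c j ^ 2 = 1 := by
    rw [hsplit (fun j t => t ^ 2) (by simp)]
    simp only [mul_pow]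
    rw [← Finset.mul_sum, sum_innovation_sq hs0 hs, innovation_sq hs0 hs, Real.sq_sqrt hsi]
    ring
  -- Only the mean and second moment of the combination are wanted, so the second family is taken to
  -- be zero.
  obtain ⟨-, -, h2, h3⟩ := indepFun_gaussian_combination (ι := Unit) (v := fun _ => 1) hZ hlZ hiid c
    (fun _ _ => 0) (by simp)
  have hG : HasGaussianLaw (fun ω => ∑ j, c j * Z j ω) μ := by
    have h := (iIndepFun.hasGaussianLaw (fun j => hasGaussianLaw_of_map_eq (hZ j) (hlZ j))
      hiid).map_fun (∑ j, c j • ContinuousLinearMap.proj (R := ℝ) (φ := fun _ => ℝ) j)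
    convert! h using 2 with ω
    simp
  have hlB : μ.map (fun ω => ∑ j, c j * Z j ω) = gaussianReal 0 1 := by
    rw [hG.map_eq_gaussianReal, variance_of_integral_eq_zero (by fun_prop) h2, h2, h3]
    simp [hvar]
  have hcm : Measurable (fun z : Fin (m + 1) → ℝ => ∑ j, c j * z j) := by fun_prop
  have hXB : IndepFun X (fun ω => ∑ j, c j * Z j ω) μ :=
    (hind.comp hcm measurable_id).symm
  rw [gaussianPair, ← hlX, ← hlB,
    ← (indepFun_iff_map_prod_eq_prod_map_map hX.aemeasurable (by fun_prop)).1 hXB,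
    Measure.map_map (by fun_prop) (by fun_prop)]
  congr 1
  funext ω
  simp [hobs]

/-- `X` and the observations from state i upwards use only noises of index at least i. The
observations below are functions of `Y_i` and of the remaining noises, which are independent of all
that. -/
theorem isDegraded_degradedObs {Ω : Type} [MeasurableSpace Ω] [StandardBorelSpace Ω]
    {μ : Measure Ω} [IsProbabilityMeasure μ] (hs0 : 0 ≤ s 0) (hs : StrictMono s)
    {X : Ω → ℝ} {Z : Fin (m + 1) → Ω → ℝ}
    (hX : Measurable X) (hZ : ∀ j, Measurable (Z j)) (hiid : iIndepFun Z μ)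
    (hind : IndepFun (fun ω j => Z j ω) X μ)
    (hY : ∀ i, Measurable fun ω => degradedObs s i (X ω) fun j => Z j ω) :
    IsDegraded X (fun i ω => degradedObs s i (X ω) fun j => Z j ω) hY μ := by
  intro i
  have hge : IndepFun (fun ω (j : {j // i ≤ j}) => Z j ω) (fun ω (j : {j // j < i}) => Z j ω) μ := by
    have h := hiid.indepFun_finset (Finset.Ici i) (Finset.Iio i)
      (Finset.disjoint_left.2 fun j hj hj' =>
        absurd (Finset.mem_Iio.1 hj') (not_lt.2 (Finset.mem_Ici.1 hj))) hZ
    have hm1 : Measurable (fun (f : Finset.Ici i → ℝ) (j : {j // i ≤ j}) =>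
        f ⟨j, Finset.mem_Ici.2 j.2⟩) := by fun_prop
    have hm2 : Measurable (fun (f : Finset.Iio i → ℝ) (j : {j // j < i}) =>
        f ⟨j, Finset.mem_Iio.2 j.2⟩) := by fun_prop
    exact h.comp hm1 hm2
  have hm : Measurable (fun z : Fin (m + 1) → ℝ =>
      ((fun j : {j // i ≤ j} => z j), fun j : {j // j < i} => z j)) := by fun_prop
  have hlt := IndepFun.assoc hX (a := fun ω (j : {j // i ≤ j}) => Z j ω)
    (b := fun ω (j : {j // j < i}) => Z j ω) (by fun_prop) (by fun_prop)
    (hind.symm.comp measurable_id hm) hge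
  -- Extension by zero lets `degradedObs` be fed with part of the noises; the filler values are
  -- never read by the observations in question.
  set up : ({j // i ≤ j} → ℝ) → Fin (m + 1) → ℝ := fun z j => if h : i ≤ j then z ⟨j, h⟩ else 0
    with hup
  set down : ({j // j < i} → ℝ) → Fin (m + 1) → ℝ := fun z j => if h : j < i then z ⟨j, h⟩ else 0
    with hdown
  have hupm : Measurable up := by
    refine measurable_pi_iff.2 fun j => ?_
    by_cases h : i ≤ j
    · simp only [hup, h, dite_true]
      fun_prop
    · simp only [hup, h, dite_false]
      fun_prop
  have hdownm : Measurable down := by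
    refine measurable_pi_iff.2 fun j => ?_
    by_cases h : j < i
    · simp only [hdown, h, dite_true]
      fun_prop
    · simp only [hdown, h, dite_false]
      fun_prop
  have hobsm : ∀ k, Measurable (fun p : ℝ × ({j // i ≤ j} → ℝ) => degradedObs s k p.1 (up p.2)) :=
    fun k => (measurable_degradedObs s k).comp
      (measurable_fst.prodMk (hupm.comp measurable_snd))
  have hobs : ∀ k, i ≤ k → ∀ ω, degradedObs s k (X ω) (up fun j => Z j ω) =
      degradedObs s k (X ω) fun j => Z j ω := fun k hk ω =>
    degradedObs_congr fun j hj => by simp [hup, hk.trans hj]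
  have h0 : CondIndepFun (MeasurableSpace.comap (fun ω => degradedObs s i (X ω) fun j => Z j ω)
      inferInstance) (hY i).comap_le (fun ω => degradedObs s i (X ω) fun j => Z j ω)
      (fun ω => (X ω, fun k : {k // i < k} => degradedObs s k (X ω) fun j => Z j ω)) μ :=
    condIndepFun_self_left (by fun_prop) (hY i)
  have hm' : Measurable (fun p : ℝ × ({j // i ≤ j} → ℝ) =>
      ((degradedObs s i p.1 (up p.2), degradedObs s i p.1 (up p.2)),
        (p.1, fun k : {k // i < k} => degradedObs s k p.1 (up p.2)))) :=
    ((hobsm i).prodMk (hobsm i)).prodMk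
      (measurable_fst.prodMk (measurable_pi_iff.2 fun k => hobsm k))
  have hnoise : IndepFun (fun ω (j : {j // j < i}) => Z j ω) (fun ω =>
      ((degradedObs s i (X ω) fun j => Z j ω, degradedObs s i (X ω) fun j => Z j ω),
        (X ω, fun k : {k // i < k} => degradedObs s k (X ω) fun j => Z j ω))) μ := by
    have h := hlt.comp measurable_id hm'
    refine h.congr (ae_of_all _ fun ω => rfl) (ae_of_all _ fun ω => ?_)
    have e : ∀ k : {k // i < k}, degradedObs s k (X ω) (up fun j => Z j ω) =
      degradedObs s k (X ω) fun j => Z j ω := fun k => hobs k k.2.le ω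
    simp only [Function.comp_apply, hobs i le_rfl, e]
  have h1 := CondIndepFun.prodMk_of_indepFun (by fun_prop) (hY i) (hY i) (by fun_prop) h0 hnoise
  have hm'' : Measurable (fun (p : ℝ × ({j // j < i} → ℝ)) (k : {k // k < i}) =>
      √(s k) * (p.1 / √(s i) + ∑ j ∈ (Finset.Ioi k.1).filter (· < i),
        innovation s j / √(s j) * down p.2 j) + innovation s k * down p.2 k) := by
    fun_prop
  have h2 := (h1.comp hm'' measurable_id).symm
  have e : ((fun (p : ℝ × ({j // j < i} → ℝ)) (k : {k // k < i}) =>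
      √(s k) * (p.1 / √(s i) + ∑ j ∈ (Finset.Ioi k.1).filter (· < i),
        innovation s j / √(s j) * down p.2 j) + innovation s k * down p.2 k) ∘
      fun ω => (degradedObs s i (X ω) fun j => Z j ω, fun j : {j // j < i} => Z j ω)) =
      fun ω (k : {k // k < i}) => degradedObs s k (X ω) fun j => Z j ω := by
    funext ω k
    rw [degradedObs_eq hs0 hs k.2]
    have hd : ∀ j, j < i → down (fun j => Z j ω) j = Z j ω := fun j hj => by simp [hdown, hj]
    simp only [Function.comp_apply, hd k k.2]
    rw [Finset.sum_congr rfl fun j hj => by rw [hd j (Finset.mem_filter.1 hj).2]]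
  rw [e] at h2
  exact h2

theorem exists_isGaussianDegradedLaw (σ : ℝ≥0) (hs0 : 0 ≤ s 0) (hs : StrictMono s) :
    ∃ (Q : Measure (ℝ × (Fin (m + 1) → ℝ))) (_ : IsProbabilityMeasure Q),
      IsGaussianDegradedLaw σ s Q := by
  obtain ⟨hlZ, hiid, hind⟩ := iid_gaussian_prod (gaussianReal 0 (σ ^ 2)) (m + 1)
  set μ := (gaussianReal 0 (σ ^ 2)).prod (Measure.pi fun _ : Fin (m + 1) => gaussianReal 0 1) with hμ
  have hlX : μ.map Prod.fst = gaussianReal 0 (σ ^ 2) := by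
    rw [hμ, Measure.map_fst_prod, measure_univ, one_smul]
  have hY := measurable_degradedObs s
  have hZ : ∀ j, Measurable fun ω : ℝ × (Fin (m + 1) → ℝ) => ω.2 j := by fun_prop
  have hm : Measurable fun ω : ℝ × (Fin (m + 1) → ℝ) => (ω.1, fun i => degradedObs s i ω.1 ω.2) :=
    by fun_prop
  have hprob : IsProbabilityMeasure (μ.map fun ω => (ω.1, fun i => degradedObs s i ω.1 ω.2)) :=
    Measure.isProbabilityMeasure_map hm.aemeasurable
  refine ⟨μ.map fun ω => (ω.1, fun i => degradedObs s i ω.1 ω.2), hprob, ?_, ?_⟩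
  · intro i
    rw [Measure.map_map (by fun_prop) hm]
    exact map_degradedObs hs0 hs measurable_fst hZ hlX hlZ hiid hind i
  · intro i
    refine (condIndepFun_iff_of_law_eq (μ' := μ) (by fun_prop) (by fun_prop)
      ((measurable_pi_apply i).comp measurable_snd) (by fun_prop) (by fun_prop) (hY i) ?_).2
      (isDegraded_degradedObs hs0 hs measurable_fst hZ hiid hind hY i)
    rw [Measure.map_map (by fun_prop) hm]
    rfl

end Existence

/-! ### The rate–distortion function -/

section RateDistortion

variable {m : ℕ} {σ : ℝ≥0} {s D : Fin (m + 1) → ℝ} {Q : Measure (ℝ × (Fin (m + 1) → ℝ))}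
  [IsProbabilityMeasure Q]

theorem gaussianRate_mem_achievableRates (hQ : IsGaussianDegradedLaw σ s Q) (hσ : 0 < σ)
    (hs0 : 0 ≤ s 0) (hs : StrictMono s) (hD : ∀ i, 0 < D i) :
    ENNReal.ofReal (gaussianRate σ s D) ∈ achievableRates Q sqDist D := by
  obtain ⟨hlN, hiid, hind⟩ := iid_gaussian_prod Q (m + 1)
  have hlaw : (Q.prod (Measure.pi fun _ : Fin (m + 1) => gaussianReal 0 1)).map
      (fun ω => (ω.1.1, fun i => ω.1.2 i)) = Q :=
    Measure.map_fst_prod.trans (by rw [measure_univ, one_smul])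
  refine ⟨(ℝ × (Fin (m + 1) → ℝ)) × (Fin (m + 1) → ℝ), inferInstance, inferInstance,
    Q.prod (Measure.pi fun _ : Fin (m + 1) => gaussianReal 0 1), inferInstance, fun _ => ℝ,
    inferInstance, inferInstance, inferInstance, fun ω => ω.1.1, fun i ω => ω.1.2 i,
    gaussianAux σ s D (fun ω => ω.1.1) fun j ω => ω.2 j, ?_, ?_⟩
  · exact isAdmissible_gaussianAux hQ hσ hs0 hs hD (by fun_prop) (by fun_prop) (by fun_prop) hlaw
      hlN hiid hind
  · exact (layeredRate_gaussianAux hQ hσ hs0 hs hD (by fun_prop) (by fun_prop) (by fun_prop) hlaw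
      hlN hiid hind).symm

theorem rateDistortion_eq_gaussianRate (hQ : IsGaussianDegradedLaw σ s Q) (hσ : 0 < σ)
    (hs0 : 0 ≤ s 0) (hs : StrictMono s) (hD : ∀ i, 0 < D i) :
    rateDistortion Q sqDist D = ENNReal.ofReal (gaussianRate σ s D) := by
  refine le_antisymm (sInf_le (gaussianRate_mem_achievableRates hQ hσ hs0 hs hD)) (le_sInf ?_)
  rintro R ⟨Ω, _, _, μ, _, 𝒲, _, _, _, X, Y, W, h, rfl⟩
  exact h.gaussianRate_le hQ hσ hs0 hs hD

/-- Nonnegativity ensures that `ENNReal.ofReal` truncates nothing, so the formula holds as an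
identity of extended reals. -/
theorem coe_ofReal_toEReal {r : ℝ} (hr : 0 ≤ r) : ((ENNReal.ofReal r : ℝ≥0∞) : EReal) = (r : EReal) := by
  rw [EReal.coe_ennreal_ofReal, max_eq_left hr]

theorem coe_rateDistortion_eq_gaussianRate (hQ : IsGaussianDegradedLaw σ s Q) (hσ : 0 < σ)
    (hs0 : 0 ≤ s 0) (hs : StrictMono s) (hD : ∀ i, 0 < D i) :
    (rateDistortion Q sqDist D : EReal) = ((gaussianRate σ s D : ℝ) : EReal) := by
  rw [rateDistortion_eq_gaussianRate hQ hσ hs0 hs hD,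
    coe_ofReal_toEReal (gaussianRate_nonneg hσ hs0 hs hD)]

end RateDistortion

end HeegardBerger

end

theorem mainTheorem3 :
    -- `M = m + 1` states
    (∀ (m : ℕ) (σ : ℝ≥0) (_hσ : 0 < σ) (s D : Fin (m + 1) → ℝ) (_hs0 : 0 ≤ s 0)
        (_hs : StrictMono s) (_hD : ∀ i, 0 < D i),
      -- physically degraded side information with the required marginals exists
      (∃ (Q : Measure (ℝ × (Fin (m + 1) → ℝ))) (_ : IsProbabilityMeasure Q),
        HeegardBerger.IsGaussianDegradedLaw σ s Q) ∧
      ∀ (Q : Measure (ℝ × (Fin (m + 1) → ℝ))) [IsProbabilityMeasure Q],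
        HeegardBerger.IsGaussianDegradedLaw σ s Q →
        -- the minimum defining `R_HB(D)` is attained and equals the formula
        HeegardBerger.rateDistortion Q HeegardBerger.sqDist D
            ∈ HeegardBerger.achievableRates Q HeegardBerger.sqDist D ∧
        (HeegardBerger.rateDistortion Q HeegardBerger.sqDist D : EReal)
            = ((HeegardBerger.gaussianRate σ s D : ℝ) : EReal) ∧
        -- it is achieved by `W_i = a_i X + N_i`
        ∀ (Ω : Type) [MeasurableSpace Ω] [StandardBorelSpace Ω] (μ : Measure Ω)
          [IsProbabilityMeasure μ] (X : Ω → ℝ) (Y N : Fin (m + 1) → Ω → ℝ),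
          Measurable X → (∀ i, Measurable (Y i)) → (∀ i, Measurable (N i)) →
          μ.map (fun ω => (X ω, fun i => Y i ω)) = Q →
          (∀ i, μ.map (N i) = gaussianReal 0 1) → iIndepFun N μ →
          IndepFun (fun ω i => N i ω) (fun ω => (X ω, fun i => Y i ω)) μ →
          HeegardBerger.IsAdmissible Q HeegardBerger.sqDist D μ X Y
            (HeegardBerger.gaussianAux σ s D X N) ∧
          (∀ i, Var[X; μ | MeasurableSpace.comap
              (HeegardBerger.obsLE Y (HeegardBerger.gaussianAux σ s D X N) i) inferInstance]
            =ᵐ[μ] fun _ => HeegardBerger.V σ s D i) ∧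
          (∀ i, (HeegardBerger.condMutualInfo X (HeegardBerger.gaussianAux σ s D X N i)
              (HeegardBerger.obsLT Y (HeegardBerger.gaussianAux σ s D X N) i) μ : EReal)
            = ((1 / 2 * Real.log (HeegardBerger.priorV σ s D i / HeegardBerger.V σ s D i) : ℝ)
                : EReal)) ∧
          HeegardBerger.layeredRate μ X Y (HeegardBerger.gaussianAux σ s D X N)
            = HeegardBerger.rateDistortion Q HeegardBerger.sqDist D) ∧
    -- the two-state formula
    (∀ (σ : ℝ≥0) (_hσ : 0 < σ) (s₁ s₂ D₁ D₂ V₁ V₂ : ℝ) (_hs₁ : 0 ≤ s₁) (_hs : s₁ < s₂)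
        (_hD₁ : 0 < D₁) (_hD₂ : 0 < D₂)
        (_hV₁ : V₁ = min ((((σ : ℝ) ^ 2)⁻¹ + s₁)⁻¹) D₁)
        (_hV₂ : V₂ = min ((V₁⁻¹ + s₂ - s₁)⁻¹) D₂)
        (Q : Measure (ℝ × (Fin 2 → ℝ))) [IsProbabilityMeasure Q],
        HeegardBerger.IsGaussianDegradedLaw σ ![s₁, s₂] Q →
        (HeegardBerger.rateDistortion Q HeegardBerger.sqDist ![D₁, D₂] : EReal)
          = ((-(1 / 2) * Real.log (((σ : ℝ) ^ 2)⁻¹ + s₁) - 1 / 2 * Real.log V₂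
              - 1 / 2 * Real.log (1 + (s₂ - s₁) * V₁) : ℝ) : EReal)) := by
  refine ⟨fun m σ hσ s D hs0 hs hD =>
    ⟨HeegardBerger.exists_isGaussianDegradedLaw σ hs0 hs, fun Q _ hQ => ⟨?_, ?_, ?_⟩⟩, ?_⟩
  · rw [HeegardBerger.rateDistortion_eq_gaussianRate hQ hσ hs0 hs hD]
    exact HeegardBerger.gaussianRate_mem_achievableRates hQ hσ hs0 hs hD
  · exact HeegardBerger.coe_rateDistortion_eq_gaussianRate hQ hσ hs0 hs hD
  · intro Ω _ _ μ _ X Y N hX hY hN hlaw hlN hiid hind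
    refine ⟨HeegardBerger.isAdmissible_gaussianAux hQ hσ hs0 hs hD hX hY hN hlaw hlN hiid hind,
      HeegardBerger.condVar_gaussianAux hQ hσ hs0 hs hD hX hY hN hlaw hlN hiid hind,
      fun i => ?_, ?_⟩
    · rw [HeegardBerger.condMutualInfo_gaussianAux hQ hσ hs0 hs hD hX hY hN hlaw hlN hiid hind,
        HeegardBerger.coe_ofReal_toEReal
          (HeegardBerger.half_log_priorV_div_V_nonneg hσ hs0 hs hD i)]
    · rw [HeegardBerger.rateDistortion_eq_gaussianRate hQ hσ hs0 hs hD,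
        HeegardBerger.layeredRate_gaussianAux hQ hσ hs0 hs hD hX hY hN hlaw hlN hiid hind]
  · intro σ hσ s₁ s₂ D₁ D₂ V₁ V₂ hs₁ hs hD₁ hD₂ hV₁ hV₂ Q _ hQ
    have hmono : StrictMono ![s₁, s₂] := by
      rw [Fin.strictMono_iff_lt_succ]
      intro i
      fin_cases i
      exact hs
    have hD : ∀ i, 0 < ![D₁, D₂] i := by
      intro i
      fin_cases i
      exacts [hD₁, hD₂]
    have h1 : HeegardBerger.V σ ![s₁, s₂] ![D₁, D₂] 0 = V₁ := hV₁.symm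
    have h2 : HeegardBerger.V σ ![s₁, s₂] ![D₁, D₂] 1 = V₂ := by
      rw [hV₂, ← h1]
      exact HeegardBerger.V_succ σ ![s₁, s₂] ![D₁, D₂] (0 : Fin 1)
    rw [HeegardBerger.coe_rateDistortion_eq_gaussianRate hQ hσ hs₁ hmono hD]
    congr 1
    simp only [HeegardBerger.gaussianRate, Finset.univ_unique, Finset.sum_singleton]
    rw [← h1, ← h2]
    rfl
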